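/- Words are finite strings, sequences are infinite strings $u_0u_1u_2\cdots$ over a finite alphabet, and $\mathcal L(\mathbf v)$ is the set of (finite) factors of a sequence $\mathbf v$. For $d\ge 3$ let $\varphi_d$ be the morphism on $\{0,1,\dots,d-1\}^*$ with $\varphi_d(i)=0(i+1)$ for $0\le i\le d-2$ and $\varphi_d(d-1)=0(d-1)(d-1)$, and let $\mathbf u_d=\lim_n\varphi_d^n(0)$ be its fixed point. For a factor $w$ of a sequence $\mathbf v$ over an alphabet $\mathcal B$ let $\mathrm{Lext}(w)=\{iw\in\mathcal L(\mathbf v): i\in\mathcal B\}$, $\mathrm{Rext}(w)=\{wi\in\mathcal L(\mathbf v): i\in\mathcal B\}$, $\mathrm{Bext}(w)=\{iwj\in\mathcal L(\mathbf v): i,j\in\mathcal B\}$, $\mathrm b(w)=\#\mathrm{Bext}(w)-\#\mathrm{Lext}(w)-\#\mathrm{Rext}(w)+1$ and, if $w$ is a palindrome, $\mathrm{Pext}(w)=\{iwi\in\mathcal L(\mathbf v): i\in\mathcal B\}$; $w$ is bispecial if $\#\mathrm{Lext}(w)\ge 2$ and $\#\mathrm{Rext}(w)\ge 2$. A word $w$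 is rich if it has exactly $|w|+1$ distinct palindromic factors (including the empty word), and a sequence is rich if all its factors are rich. **Proposition.** Let $d\ge 3$ and let $\eta:\{0,1,\dots,d-1\}^*\to\mathcal B^*$ be a morphism of class $P_{\mathrm{ret}}$ with common palindrome $p$, i.e. $\eta$ is injective, $p\in\mathcal B^*$ is a palindrome, and for every letter $i$ we have $\eta(i)=pq_i$ with $q_i$ a palindrome, and $\eta(i)p$ is a complete return word to $p$ (that is, $\eta(i)$ is non-empty and $p$ occurs in $\eta(i)p$ exactly twice, once as a prefix and once as a suffix). Suppose that every bispecial factor $w$ of $\eta(\mathbf u_d)$ that does not contain $p$ as a factor satisfies - $\mathrm b(w)=0$ if $w$ is not a palindrome; - $\mathrm b(w)=\#\mathrm{Pext}(w)-1$ if $w$ is a palindrome. Then $\eta(\mathbf u_d)$ is rich. -/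

import Mathlib

namespace RichWords

/-! ### Words and sequences

Words over `A` are lists over `A`, sequences are functions `ℕ → A`. -/

/-- The word `u_j u_{j+1} ⋯ u_{j+n-1}`. -/
def block {A : Type*} (u : ℕ → A) (j n : ℕ) : List A :=
  (List.range n).map fun k => u (j + k)

/-- The language of a sequence: the set of its factors. -/
def language {A : Type*} (u : ℕ → A) : Set (List A) :=
  {w | ∃ j : ℕ, w = block u j w.length}

/-- `j` is an occurrence of the word `p` in the word `z`. -/
def OccursAt {A : Type*} (p z : List A) (j : ℕ) : Prop :=
  ∃ s t : List A, z = s ++ p ++ t ∧ s.length = j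

/-- `z` is a complete return word to `p`: `z = r ++ p` with `r` non-empty, and `p` occurs in `z`
exactly twice, once as a prefix and once as a suffix. -/
def IsCompleteReturn {A : Type*} (p z : List A) : Prop :=
  ∃ r : List A, r ≠ [] ∧ z = r ++ p ∧ ∀ j : ℕ, OccursAt p z j ↔ (j = 0 ∨ j = r.length)

/-! ### Extensions, bispecial factors, bilateral order -/

/-- Left extensions of `w`. -/
def Lext {A : Type*} (u : ℕ → A) (w : List A) : Set (List A) :=
  {z | z ∈ language u ∧ ∃ i : A, z = i :: w}

/-- Right extensions of `w`. -/
def Rext {A : Type*} (u : ℕ → A) (w : List A) : Set (List A) :=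
  {z | z ∈ language u ∧ ∃ i : A, z = w ++ [i]}

/-- Both-sided extensions of `w`. -/
def Bext {A : Type*} (u : ℕ → A) (w : List A) : Set (List A) :=
  {z | z ∈ language u ∧ ∃ i j : A, z = i :: (w ++ [j])}

/-- Palindromic extensions of `w`. -/
def Pext {A : Type*} (u : ℕ → A) (w : List A) : Set (List A) :=
  {z | z ∈ language u ∧ ∃ i : A, z = i :: (w ++ [i])}

/-- `w` is a left special factor of `u`. -/
def IsLeftSpecial {A : Type*} (u : ℕ → A) (w : List A) : Prop :=
  w ∈ language u ∧ ∃ i j : A, i ≠ j ∧ i :: w ∈ language u ∧ j :: w ∈ language u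

/-- `w` is a right special factor of `u`. -/
def IsRightSpecial {A : Type*} (u : ℕ → A) (w : List A) : Prop :=
  w ∈ language u ∧ ∃ i j : A, i ≠ j ∧ w ++ [i] ∈ language u ∧ w ++ [j] ∈ language u

/-- `w` is a bispecial factor of `u`. -/
def IsBispecial {A : Type*} (u : ℕ → A) (w : List A) : Prop :=
  IsLeftSpecial u w ∧ IsRightSpecial u w

/-- The bilateral order `b(w) = #Bext(w) - #Lext(w) - #Rext(w) + 1`. -/
noncomputable def bilateralOrder {A : Type*} (u : ℕ → A) (w : List A) : ℤ :=
  ((Bext u w).ncard : ℤ) - ((Lext u w).ncard : ℤ) - ((Rext u w).ncard : ℤ) + 1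

/-! ### Richness -/

/-- A word `w` is rich if it has exactly `|w| + 1` distinct palindromic factors (the empty word
included). -/
def IsRichWord {A : Type*} (w : List A) : Prop :=
  {x : List A | x <:+: w ∧ x.Palindrome}.ncard = w.length + 1

/-- A sequence is rich if each of its factors is rich. -/
def IsRich {A : Type*} (u : ℕ → A) : Prop :=
  ∀ w ∈ language u, IsRichWord w

/-! ### Morphisms

A morphism of free monoids is given by its values on letters. -/

/-- The morphism with letter images `σ`, applied to a word. -/
def onWord {A B : Type*} (σ : A → List B) (w : List A) : List B :=
  w.flatMap σ

theorem le_length_onWord {A B : Type*} (σ : A → List B) (c : ℕ) (h : ∀ a, c ≤ (σ a).length)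
    (w : List A) : c * w.length ≤ (onWord σ w).length := by
  induction w with
  | nil => simp
  | cons a w ih =>
    have := h a
    simp only [onWord, List.flatMap_cons, List.length_append, List.length_cons] at ih ⊢
    linarith

theorem lt_length_onWord_block {A B : Type*} (σ : A → List B) (h : ∀ a, σ a ≠ []) (u : ℕ → A)
    (n : ℕ) : n < (onWord σ (block u 0 (n + 1))).length := by
  have := le_length_onWord σ 1 (fun a => List.length_pos_iff.mpr (h a)) (block u 0 (n + 1))
  simp only [block, List.length_map, List.length_range] at this ⊢
  omega

/-- The image `σ(u_0) σ(u_1) σ(u_2) ⋯` of a sequence under a morphism that erases no letter. Its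
`n`-th letter is the `n`-th letter of `σ(u_0 ⋯ u_n)`, a word of length at least `n + 1`. -/
def onSeq {A B : Type*} (σ : A → List B) (h : ∀ a, σ a ≠ []) (u : ℕ → A) : ℕ → B :=
  fun n => (onWord σ (block u 0 (n + 1)))[n]'(lt_length_onWord_block σ h u n)

/-- The morphism with letter images `η` is of class `P_ret`, with common palindrome `p`. -/
structure IsClassPret {A B : Type*} (η : A → List B) (p : List B) : Prop where
  injective : Function.Injective (onWord η)
  palindrome : p.Palindrome
  eq_append : ∀ i, ∃ q : List B, q.Palindrome ∧ η i = p ++ q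
  completeReturn : ∀ i, IsCompleteReturn p (η i ++ p)

theorem IsClassPret.ne_nil {A B : Type*} {η : A → List B} {p : List B} (h : IsClassPret η p) :
    ∀ i, η i ≠ [] := by
  intro i hi
  obtain ⟨r, hr, hz, -⟩ := h.completeReturn i
  rw [List.append_cancel_right hz] at hi
  exact hr hi

/-! ### The sequence `u_d` -/

/-- The morphism `φ_d` on `{0, …, d-1}`: `i ↦ 0 (i+1)` for `i < d - 1`, and
`d-1 ↦ 0 (d-1) (d-1)`. -/
def phi (d : ℕ) (i : Fin d) : List (Fin d) :=
  if h : (i : ℕ) + 1 < d then [⟨0, i.pos⟩, ⟨(i : ℕ) + 1, h⟩] else [⟨0, i.pos⟩, i, i]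

theorem two_le_length_phi (d : ℕ) (i : Fin d) : 2 ≤ (phi d i).length := by
  unfold phi
  split <;> simp

theorem phi_ne_nil (d : ℕ) (i : Fin d) : phi d i ≠ [] := by
  have := two_le_length_phi d i
  intro h
  simp [h] at this

/-- The word `φ_d^n(0)`. -/
def phiIter (d : ℕ) (hd : 3 ≤ d) (n : ℕ) : List (Fin d) :=
  (onWord (phi d))^[n] [⟨0, by omega⟩]

theorem phiIter_succ (d : ℕ) (hd : 3 ≤ d) (n : ℕ) :
    phiIter d hd (n + 1) = onWord (phi d) (phiIter d hd n) :=
  Function.iterate_succ_apply' _ _ _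

theorem lt_length_phiIter (d : ℕ) (hd : 3 ≤ d) (n : ℕ) : n < (phiIter d hd n).length := by
  induction n with
  | zero => simp [phiIter]
  | succ n ih =>
    rw [phiIter_succ]
    have := le_length_onWord (phi d) 2 (two_le_length_phi d) (phiIter d hd n)
    omega

/-- The sequence `u_d`, the fixed point of `φ_d`: the limit of the words `φ_d^n(0)`, each of which
is a prefix of the next one. -/
def uSeq (d : ℕ) (hd : 3 ≤ d) : ℕ → Fin d :=
  fun n => (phiIter d hd n)[n]'(lt_length_phiIter d hd n)

theorem onWord_prefix {A B : Type*} (σ : A → List B) {v w : List A} (h : v <+: w) :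
    onWord σ v <+: onWord σ w := by
  obtain ⟨t, rfl⟩ := h
  exact ⟨onWord σ t, by simp [onWord]⟩

theorem phiIter_prefix (d : ℕ) (hd : 3 ≤ d) {m n : ℕ} (h : m ≤ n) :
    phiIter d hd m <+: phiIter d hd n := by
  have step : ∀ k, phiIter d hd k <+: phiIter d hd (k + 1) := by
    intro k
    induction k with
    | zero =>
      refine ⟨[⟨1, by omega⟩], ?_⟩
      have : 1 < d := by omega
      simp [phiIter, onWord, phi, this]
    | succ k ih =>
      rw [phiIter_succ, phiIter_succ d hd (k + 1)]
      exact onWord_prefix _ ih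
  induction n, h using Nat.le_induction with
  | base => exact List.prefix_refl _
  | succ n _ ih => exact ih.trans (step n)

theorem uSeq_eq (d : ℕ) (hd : 3 ≤ d) (n k : ℕ) (hk : k < (phiIter d hd n).length) :
    uSeq d hd k = (phiIter d hd n)[k] := by
  rcases le_total k n with h | h
  · exact (phiIter_prefix d hd h).getElem _
  · exact ((phiIter_prefix d hd h).getElem hk).symm

theorem block_uSeq_prefix (d : ℕ) (hd : 3 ≤ d) (n : ℕ) :
    block (uSeq d hd) 0 (n + 1) <+: phiIter d hd n := by
  have hl := lt_length_phiIter d hd n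
  have : block (uSeq d hd) 0 (n + 1) = (phiIter d hd n).take (n + 1) := by
    apply List.ext_getElem
    · simp [block]; omega
    · intro k h1 h2
      simp only [block, List.getElem_map, List.getElem_range, List.getElem_take, zero_add]
      exact uSeq_eq d hd n k _
  rw [this]
  exact List.take_prefix _ _

/-- `u_d` is a fixed point of `φ_d`. -/
theorem onSeq_phi_uSeq (d : ℕ) (hd : 3 ≤ d) :
    onSeq (phi d) (phi_ne_nil d) (uSeq d hd) = uSeq d hd := by
  funext n
  have hp := onWord_prefix (phi d) (block_uSeq_prefix d hd n)
  rw [← phiIter_succ] at hp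
  have hn := lt_length_onWord_block (phi d) (phi_ne_nil d) (uSeq d hd) n
  rw [uSeq_eq d hd (n + 1) n (hn.trans_le hp.length_le)]
  exact hp.getElem hn

end RichWords

/-! The proof joins a counting criterion for richness to a transfer of extension patterns through
morphisms of class `P_ret`.

Criterion (`isRich_of_bispecial`). Arbitrarily long palindromic prefixes make the language closed
under reversal. If all bispecial factors have the prescribed bilateral order, so have all factors.
Summing over length `n` gives P(n) + P(n+1) = C(n+1) - C(n) + 2, where P and C count palindromic
factors and all factors. Take as vertices the factors of length `n` up to reversal and as edges the
non-palindromic factors of length `n+1` up to reversal. The identity says that there is one vertex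
more than edges, and the sequence walks through the whole graph, so the graph is a tree. A
non-palindromic complete return to a palindrome would close a cycle in such a tree
(`palindrome_of_return`). Once all complete returns to palindromes are palindromes, each new letter
of a word creates exactly one new palindrome, which is richness.

Transfer (`IsClassPret.isRegular`). A factor `w` of η(u) containing `p` is s η(x) p tᴿ for a unique
`x`, and the extensions of `w` arise from those of `x` by discarding and identifying letters. The
bilateral order of `x` alone does not control this, but the shape of the extension relation does: a
star with loops for palindromes, a double star otherwise. These shapes survive whenever `w` is
bispecial, and they force the prescribed order.

The morphism φ_d is itself of class `P_ret` with `p` = 0 and fixes u_d. Induction on length thus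
makes every bispecial factor of u_d regular, the base being the empty word and the letter d-1
(`isRegular_uSeq`). One more transfer, by η, treats the factors containing `p`; the hypothesis
treats the others. -/

namespace RichWords

/-! ### Blocks and languages -/

section Language

variable {A : Type*} {u : ℕ → A}

@[simp]
theorem length_block (u : ℕ → A) (j n : ℕ) : (block u j n).length = n := by
  simp [block]

@[simp]
theorem block_zero (u : ℕ → A) (j : ℕ) : block u j 0 = [] := rfl

theorem getElem_block (u : ℕ → A) (j n k : ℕ) (h : k < (block u j n).length) :
    (block u j n)[k] = u (j + k) := by
  simp [block]

theorem block_add (u : ℕ → A) (j m n : ℕ) :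
    block u j (m + n) = block u j m ++ block u (j + m) n := by
  simp [block, List.range_add, add_assoc]

theorem block_one (u : ℕ → A) (j : ℕ) : block u j 1 = [u j] := by
  simp [block]

theorem block_succ (u : ℕ → A) (j n : ℕ) : block u j (n + 1) = block u j n ++ [u (j + n)] := by
  rw [block_add, block_one]

theorem block_succ' (u : ℕ → A) (j n : ℕ) : block u j (n + 1) = u j :: block u (j + 1) n := by
  rw [add_comm, block_add, block_one, List.singleton_append]

theorem block_mem_language (u : ℕ → A) (j n : ℕ) : block u j n ∈ language u :=
  ⟨j, by simp⟩

theorem eq_block_of_append_eq {s w t : List A} {j n : ℕ} (h : block u j n = s ++ w ++ t) :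
    s = block u j s.length ∧ w = block u (j + s.length) w.length ∧
      t = block u (j + s.length + w.length) t.length := by
  have hn : n = s.length + w.length + t.length := by
    simpa [add_assoc] using congrArg List.length h
  rw [hn, block_add, block_add] at h
  obtain ⟨h1, h2⟩ := List.append_inj h (by simp)
  obtain ⟨h3, h4⟩ := List.append_inj h1 (by simp)
  exact ⟨h3.symm, h4.symm, by rw [← h2, length_block, add_assoc]⟩

theorem mem_language_of_infix {w z : List A} (hz : z ∈ language u) (h : w <:+: z) :
    w ∈ language u := by
  obtain ⟨j, hj⟩ := hz
  obtain ⟨s, t, rfl⟩ := h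
  exact ⟨_, (eq_block_of_append_eq hj.symm).2.1⟩

theorem exists_append_mem {w : List A} (hw : w ∈ language u) : ∃ b, w ++ [b] ∈ language u := by
  obtain ⟨j, hj⟩ := hw
  refine ⟨u (j + w.length), ?_⟩
  rw [hj, length_block, ← block_succ]
  exact block_mem_language _ _ _

/-- The sequence has arbitrarily long palindromic prefixes. -/
def HasPalPrefixes (u : ℕ → A) : Prop :=
  ∀ N, ∃ n ≥ N, (block u 0 n).Palindrome

/-- Every factor lies in some palindromic prefix, which also contains the mirror image of the
factor. -/
theorem HasPalPrefixes.reverse_mem (h : HasPalPrefixes u) {w : List A} (hw : w ∈ language u) :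
    w.reverse ∈ language u := by
  obtain ⟨j, hj⟩ := hw
  obtain ⟨n, hn, hp⟩ := h (j + w.length)
  obtain ⟨k, rfl⟩ := Nat.exists_eq_add_of_le hn
  refine mem_language_of_infix (block_mem_language u 0 (j + w.length + k)) ?_
  rw [← hp.reverse_eq, List.reverse_infix, block_add, block_add, zero_add, ← hj]
  exact ⟨_, _, rfl⟩

theorem HasPalPrefixes.exists_cons_mem (h : HasPalPrefixes u) {w : List A}
    (hw : w ∈ language u) : ∃ a, a :: w ∈ language u := by
  obtain ⟨a, ha⟩ := exists_append_mem (h.reverse_mem hw)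
  exact ⟨a, by simpa using h.reverse_mem ha⟩

theorem infix_cons_append {w : List A} (a b : A) : w <:+: a :: (w ++ [b]) :=
  ⟨[a], [b], by simp⟩

theorem append_infix_cons_append {w : List A} (a b : A) : w ++ [b] <:+: a :: (w ++ [b]) :=
  ⟨[a], [], by simp⟩

theorem cons_infix_cons_append {w : List A} (a b : A) : a :: w <:+: a :: (w ++ [b]) :=
  ⟨[], [b], by simp⟩

theorem exists_eq_cons_append {z : List A} {n : ℕ} (h : z.length = n + 2) :
    ∃ a w b, z = a :: (w ++ [b]) ∧ w.length = n := by
  obtain ⟨a, z', rfl⟩ := List.exists_cons_of_length_eq_add_one h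
  rcases List.eq_nil_or_concat' z' with rfl | ⟨w, b, rfl⟩
  · simp at h
  · exact ⟨a, w, b, rfl, by simpa using h⟩

theorem palindrome_cons_append_iff {w : List A} {a b : A} :
    (a :: (w ++ [b])).Palindrome ↔ a = b ∧ w.Palindrome := by
  rw [List.Palindrome.iff_reverse_eq, List.Palindrome.iff_reverse_eq]
  simp only [List.reverse_cons, List.reverse_append, List.reverse_nil, List.nil_append,
    List.cons_append, List.cons.injEq]
  constructor
  · rintro ⟨rfl, h⟩
    exact ⟨rfl, (List.append_inj' h rfl).1⟩
  · rintro ⟨rfl, h⟩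
    exact ⟨rfl, by rw [h]⟩

end Language

/-! ### Richness from palindromic complete returns -/

section Returns

variable {A : Type*} {u : ℕ → A}

theorem finite_palindromic_infix (w : List A) :
    {x : List A | x <:+: w ∧ x.Palindrome}.Finite := by
  classical
  refine Set.Finite.subset (w.sublists.toFinset.finite_toSet) ?_
  intro x hx
  simpa using hx.1.sublist

/-- If every complete return to a palindrome is a palindrome, then every factor is rich. -/
theorem isRich_of_palindromic_returns
    (H : ∀ v z : List A, v.Palindrome → z ∈ language u → v <+: z → v <:+ z →
      (∀ j, OccursAt v z j → j = 0 ∨ j + v.length = z.length) → z.Palindrome) :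
    IsRich u := by
  classical
  intro w
  induction w using List.reverseRecOn with
  | nil =>
    intro _
    have : {x : List A | x <:+: [] ∧ x.Palindrome} = {[]} := by
      ext x
      simp only [Set.mem_ofPred_eq, List.infix_nil, Set.mem_singleton_iff]
      exact ⟨fun h => h.1, fun h => ⟨h, h ▸ List.Palindrome.nil⟩⟩
    rw [IsRichWord, this, Set.ncard_singleton, List.length_nil]
  | append_singleton w a ih =>
    intro hw
    have hwr := ih (mem_language_of_infix hw ⟨[], [a], by simp⟩)
    -- The longest palindromic suffix `s` is the only palindrome that the letter `a` adds.
    obtain ⟨s, ⟨hs, hsp⟩, hmax⟩ : ∃ s, (s <:+ w ++ [a] ∧ s.Palindrome) ∧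
        ∀ x, x <:+ w ++ [a] ∧ x.Palindrome → x.length ≤ s.length := by
      have hfin : {x : List A | x <:+ w ++ [a] ∧ x.Palindrome}.Finite :=
        (finite_palindromic_infix (w ++ [a])).subset fun x hx => ⟨hx.1.isInfix, hx.2⟩
      obtain ⟨s, h1, h2⟩ := Set.exists_max_image _ List.length hfin
        ⟨[], List.nil_suffix, List.Palindrome.nil⟩
      exact ⟨s, h1, h2⟩
    have hnew : ¬ s <:+: w := by
      intro hsw
      -- Take the last occurrence of `s` before the final one, that is, the shortest `y`. Then `s ++
      -- y` is a complete return to `s`, hence a palindromic suffix longer than `s`.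
      have hex : ∃ n, ∃ x y : List A, w ++ [a] = x ++ s ++ y ∧ y ≠ [] ∧ y.length = n := by
        obtain ⟨x, y, h⟩ := hsw
        exact ⟨_, x, y ++ [a], by simp [← h], by simp, rfl⟩
      obtain ⟨x, y, hxy, hy, hlen⟩ := Nat.find_spec hex
      have hmin := fun m hm => Nat.find_min hex (m := m) hm
      rw [← hlen] at hmin
      have hzs : s ++ y <:+ w ++ [a] := ⟨x, by rw [hxy, List.append_assoc]⟩
      have hy' := List.length_pos_iff.mpr hy
      have hz : (s ++ y).Palindrome := by
        refine H s _ hsp (mem_language_of_infix hw hzs.isInfix) (List.prefix_append _ _)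
          (List.suffix_of_suffix_length_le hs hzs (by simp)) ?_
        rintro j ⟨s1, t1, h1, rfl⟩
        by_contra! hc
        have hl := congrArg List.length h1
        simp only [List.length_append] at hl hc
        refine hmin t1.length (by omega) ⟨x ++ s1, t1, ?_, ?_, rfl⟩
        · rw [hxy, List.append_assoc, h1]
          simp
        · rintro rfl
          simp at hl
          omega
      have := hmax _ ⟨hzs, hz⟩
      rw [List.length_append] at this
      omega
    -- A palindrome that is new is a suffix, hence a suffix of `s`. By reflection it is also a
    -- prefix of `s`, and if it were shorter than `s` it would already occur in `w`.
    have hset : {x : List A | x <:+: w ++ [a] ∧ x.Palindrome} =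
        insert s {x : List A | x <:+: w ∧ x.Palindrome} := by
      ext x
      simp only [Set.mem_ofPred_eq, Set.mem_insert_iff]
      constructor
      · rintro ⟨hx, hxp⟩
        by_cases hxw : x <:+: w
        · exact Or.inr ⟨hxw, hxp⟩
        left
        have hxs : x <:+ w ++ [a] := by
          obtain ⟨q, r, hqr⟩ := hx
          rcases List.eq_nil_or_concat' r with rfl | ⟨r', b, rfl⟩
          · exact ⟨q, by simpa using hqr⟩
          · rw [← List.append_assoc] at hqr
            exact absurd ⟨q, r', (List.append_inj' hqr rfl).1⟩ hxw
        have hle := hmax x ⟨hxs, hxp⟩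
        have hxs' : x <:+ s := List.suffix_of_suffix_length_le hxs hs hle
        have hpre : x <+: s := by
          have := List.reverse_prefix.mpr hxs'
          rwa [hxp.reverse_eq, hsp.reverse_eq] at this
        obtain ⟨y, hy⟩ := hpre
        rcases List.eq_nil_or_concat' y with rfl | ⟨y', b, rfl⟩
        · simpa using hy
        · obtain ⟨q, hq⟩ := hs
          rw [← hy, ← List.append_assoc, ← List.append_assoc] at hq
          exact absurd ⟨q, y', (List.append_inj' hq rfl).1⟩ hxw
      · rintro (rfl | ⟨hx, hxp⟩)
        · exact ⟨hs.isInfix, hsp⟩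
        · exact ⟨hx.trans ⟨[], [a], by simp⟩, hxp⟩
    unfold IsRichWord at hwr ⊢
    rw [hset, Set.ncard_insert_of_notMem (fun h => hnew h.1) (finite_palindromic_infix w), hwr]
    simp

end Returns

/-! ### Extension relations -/

section Relations

variable {A : Type*} {u : ℕ → A}

/-- The extension relation of `w`: the pairs `(a, b)` with `a w b` in the language. -/
def Ext (u : ℕ → A) (w : List A) (a b : A) : Prop :=
  a :: (w ++ [b]) ∈ language u

/-- The bilateral order of an extension relation. -/
noncomputable def relOrder (r : A → A → Prop) : ℤ :=
  ({q : A × A | r q.1 q.2}.ncard : ℤ) - ({a | ∃ b, r a b}.ncard : ℤ)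
    - ({b | ∃ a, r a b}.ncard : ℤ) + 1

/-- Two different letters occur on the left in the relation. -/
def RelSpecial (r : A → A → Prop) : Prop :=
  ∃ a a', a ≠ a' ∧ (∃ b, r a b) ∧ ∃ b, r a' b

theorem relOrder_flip (r : A → A → Prop) : relOrder (flip r) = relOrder r := by
  have h : {q : A × A | flip r q.1 q.2}.ncard = {q : A × A | r q.1 q.2}.ncard := by
    rw [← Set.ncard_image_of_injective _ Prod.swap_injective]
    congr 1
    ext ⟨a, b⟩
    simp [flip]
  unfold relOrder
  rw [h]
  simp only [flip]
  ring

/-- With a single left letter the pairs correspond to the right letters, so the order is n - 1 - n +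
1. -/
theorem relOrder_eq_zero_of_not_special {r : A → A → Prop} (h : ¬ RelSpecial r)
    {a₀ b₀ : A} (h₀ : r a₀ b₀) : relOrder r = 0 := by
  have huniq : ∀ a b, r a b → a = a₀ := by
    intro a b hab
    by_contra hne
    exact h ⟨a, a₀, hne, ⟨b, hab⟩, ⟨b₀, h₀⟩⟩
  have h1 : {a | ∃ b, r a b} = {a₀} := by
    ext a
    exact ⟨fun ⟨b, hb⟩ => huniq a b hb, fun h => ⟨b₀, (show a = a₀ from h) ▸ h₀⟩⟩
  have h2 : {q : A × A | r q.1 q.2}.ncard = {b | ∃ a, r a b}.ncard := by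
    rw [← Set.ncard_image_of_injective {b | ∃ a, r a b} (Prod.mk_right_injective a₀)]
    congr 1
    ext ⟨a, b⟩
    simp only [Set.mem_ofPred_eq, Set.mem_image, Prod.mk.injEq]
    constructor
    · exact fun hab => ⟨b, ⟨a, hab⟩, (huniq a b hab).symm, rfl⟩
    · rintro ⟨b', ⟨a', h'⟩, rfl, rfl⟩
      exact huniq _ _ h' ▸ h'
  unfold relOrder
  rw [h1, h2, Set.ncard_singleton]
  push_cast
  ring

theorem exists_ext_right {w : List A} {a : A} :
    (∃ b, Ext u w a b) ↔ a :: w ∈ language u := by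
  constructor
  · rintro ⟨b, hb⟩
    exact mem_language_of_infix hb (cons_infix_cons_append a b)
  · exact fun h => exists_append_mem h

theorem HasPalPrefixes.exists_ext_left (hu : HasPalPrefixes u) {w : List A} {b : A} :
    (∃ a, Ext u w a b) ↔ w ++ [b] ∈ language u := by
  constructor
  · rintro ⟨a, ha⟩
    exact mem_language_of_infix ha (append_infix_cons_append a b)
  · exact fun h => hu.exists_cons_mem h

theorem HasPalPrefixes.exists_ext (hu : HasPalPrefixes u) {w : List A} (hw : w ∈ language u) :
    ∃ a b, Ext u w a b := by
  obtain ⟨a, ha⟩ := hu.exists_cons_mem hw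
  exact ⟨a, exists_ext_right.mpr ha⟩

theorem HasPalPrefixes.ext_symm (hu : HasPalPrefixes u) {w : List A} (hw : w.Palindrome)
    {a b : A} (h : Ext u w a b) : Ext u w b a := by
  simpa [Ext, hw.reverse_eq] using hu.reverse_mem h

theorem HasPalPrefixes.isBispecial_iff (hu : HasPalPrefixes u) {w : List A} :
    IsBispecial u w ↔ RelSpecial (Ext u w) ∧ RelSpecial (flip (Ext u w)) := by
  simp only [IsBispecial, IsLeftSpecial, IsRightSpecial, RelSpecial, flip, exists_ext_right,
    hu.exists_ext_left]
  constructor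
  · exact fun h => ⟨h.1.2, h.2.2⟩
  · rintro ⟨⟨a, a', hne, h1, h2⟩, h⟩
    have hw : w ∈ language u := mem_language_of_infix h1 ⟨[a], [], by simp⟩
    exact ⟨⟨hw, a, a', hne, h1, h2⟩, hw, h⟩

theorem HasPalPrefixes.bilateralOrder_eq (hu : HasPalPrefixes u) (w : List A) :
    bilateralOrder u w = relOrder (Ext u w) := by
  have h1 : (Lext u w).ncard = {a | ∃ b, Ext u w a b}.ncard := by
    have hinj : Function.Injective fun a : A => a :: w := fun b c h => by simpa using h
    rw [← Set.ncard_image_of_injective _ hinj]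
    congr 1
    ext z
    simp only [Lext, Set.mem_ofPred_eq, Set.mem_image, exists_ext_right]
    constructor
    · rintro ⟨h, i, rfl⟩
      exact ⟨i, h, rfl⟩
    · rintro ⟨i, h, rfl⟩
      exact ⟨h, i, rfl⟩
  have h2 : (Rext u w).ncard = {b | ∃ a, Ext u w a b}.ncard := by
    have hinj : Function.Injective fun b : A => w ++ [b] := fun b c h => by simpa using h
    rw [← Set.ncard_image_of_injective _ hinj]
    congr 1
    ext z
    simp only [Rext, Set.mem_ofPred_eq, Set.mem_image, hu.exists_ext_left]
    constructor
    · rintro ⟨h, i, rfl⟩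
      exact ⟨i, h, rfl⟩
    · rintro ⟨i, h, rfl⟩
      exact ⟨h, i, rfl⟩
  have h3 : (Bext u w).ncard = {q : A × A | Ext u w q.1 q.2}.ncard := by
    have hinj : Function.Injective fun q : A × A => q.1 :: (w ++ [q.2]) := by
      rintro ⟨a, b⟩ ⟨c, e⟩ h
      simpa using h
    rw [← Set.ncard_image_of_injective _ hinj]
    congr 1
    ext z
    simp only [Bext, Set.mem_ofPred_eq, Set.mem_image, Prod.exists]
    constructor
    · rintro ⟨h, i, j, rfl⟩
      exact ⟨i, j, h, rfl⟩
    · rintro ⟨i, j, h, rfl⟩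
      exact ⟨h, i, j, rfl⟩
  rw [bilateralOrder, relOrder, h1, h2, h3]

theorem ncard_Pext (u : ℕ → A) (w : List A) :
    (Pext u w).ncard = {a | Ext u w a a}.ncard := by
  have hinj : Function.Injective fun a : A => a :: (w ++ [a]) := by
    intro a b h
    exact (List.cons.inj h).1
  rw [← Set.ncard_image_of_injective _ hinj]
  congr 1
  ext z
  simp only [Pext, Set.mem_ofPred_eq, Set.mem_image]
  constructor
  · rintro ⟨h, i, rfl⟩
    exact ⟨i, h, rfl⟩
  · rintro ⟨i, h, rfl⟩
    exact ⟨h, i, rfl⟩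

/-- The bilateral order prescribed for the factors of a rich sequence. -/
def HasRichOrder (u : ℕ → A) (w : List A) : Prop :=
  (¬ w.Palindrome → bilateralOrder u w = 0) ∧
    (w.Palindrome → bilateralOrder u w = ((Pext u w).ncard : ℤ) - 1)

/-- One side has a single letter, so the order is 0. For a palindrome the relation is symmetric, so
both sides reduce to the same letter `a`, and `a w a` is the only palindromic extension. -/
theorem HasPalPrefixes.hasRichOrder_of_not_bispecial (hu : HasPalPrefixes u) {w : List A}
    (hw : w ∈ language u) (h : ¬ IsBispecial u w) : HasRichOrder u w := by
  obtain ⟨a, b, hab⟩ := hu.exists_ext hw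
  rw [hu.isBispecial_iff, not_and_or] at h
  have hz : bilateralOrder u w = 0 := by
    rw [hu.bilateralOrder_eq]
    rcases h with h | h
    · exact relOrder_eq_zero_of_not_special h hab
    · rw [← relOrder_flip]
      exact relOrder_eq_zero_of_not_special h hab
  refine ⟨fun _ => hz, fun hp => ?_⟩
  have hsp : ¬ RelSpecial (Ext u w) := by
    rcases h with h | h
    · exact h
    · rintro ⟨x, y, hxy, ⟨c, hc⟩, ⟨e, he⟩⟩
      exact h ⟨x, y, hxy, ⟨c, hu.ext_symm hp hc⟩, ⟨e, hu.ext_symm hp he⟩⟩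
  have huniq : ∀ x y, Ext u w x y → x = a := by
    intro x y hxy
    by_contra hne
    exact hsp ⟨x, a, hne, ⟨y, hxy⟩, ⟨b, hab⟩⟩
  have hba : b = a := huniq b a (hu.ext_symm hp hab)
  have : {x | Ext u w x x} = {a} := by
    ext x
    constructor
    · exact fun hx => huniq x x hx
    · rintro rfl
      exact hba ▸ hab
  rw [hz, ncard_Pext, this, Set.ncard_singleton]
  norm_num

end Relations

/-! ### Counting factors and palindromes -/

section Counting

open Finset

variable {A : Type*} [Finite A] {u : ℕ → A}

theorem finite_factors_of_length (u : ℕ → A) (n : ℕ) :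
    {w | w ∈ language u ∧ w.length = n}.Finite :=
  (List.finite_length_eq A n).subset fun _ h => h.2

/-- The factors of length `n`. -/
noncomputable def factors (u : ℕ → A) (n : ℕ) : Finset (List A) :=
  (finite_factors_of_length u n).toFinset

@[simp]
theorem mem_factors {w : List A} {n : ℕ} :
    w ∈ factors u n ↔ w ∈ language u ∧ w.length = n := by
  simp [factors]

open Classical in
/-- The palindromic factors of length `n`. -/
noncomputable def palFactors (u : ℕ → A) (n : ℕ) : Finset (List A) :=
  {w ∈ factors u n | w.Palindrome}

@[simp]
theorem mem_palFactors {w : List A} {n : ℕ} :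
    w ∈ palFactors u n ↔ (w ∈ language u ∧ w.length = n) ∧ w.Palindrome := by
  simp [palFactors]

theorem card_eq_sum_ncard_fiber {α β : Type*} {S : Finset α} {T : Finset β} (f : α → β)
    (E : β → Set α) (hf : ∀ z ∈ S, f z ∈ T)
    (hE : ∀ w ∈ T, ∀ z, z ∈ E w ↔ z ∈ S ∧ f z = w) :
    #S = ∑ w ∈ T, (E w).ncard := by
  classical
  rw [card_eq_sum_card_fiberwise hf]
  refine sum_congr rfl fun w hw => ?_
  rw [← Set.ncard_coe_finset]
  congr 1
  ext z
  simp [hE w hw z]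

theorem sum_ncard_Bext (u : ℕ → A) (n : ℕ) :
    #(factors u (n + 2)) = ∑ w ∈ factors u n, (Bext u w).ncard := by
  refine card_eq_sum_ncard_fiber (fun z => z.tail.dropLast) _ ?_ ?_
  · intro z hz
    rw [mem_factors] at hz
    obtain ⟨a, w, b, rfl, hw⟩ := exists_eq_cons_append hz.2
    simpa [hw] using mem_language_of_infix hz.1 (infix_cons_append a b)
  · intro w hw z
    rw [mem_factors] at hw
    constructor
    · rintro ⟨h, i, j, rfl⟩
      simp [h, hw.2]
    · rintro ⟨hz, rfl⟩
      rw [mem_factors] at hz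
      obtain ⟨a, w, b, rfl, -⟩ := exists_eq_cons_append hz.2
      exact ⟨hz.1, a, b, by simp⟩

theorem sum_ncard_Lext (u : ℕ → A) (n : ℕ) :
    #(factors u (n + 1)) = ∑ w ∈ factors u n, (Lext u w).ncard := by
  refine card_eq_sum_ncard_fiber (fun z => z.tail) _ ?_ ?_
  · intro z hz
    rw [mem_factors] at hz
    simpa [hz.2] using mem_language_of_infix hz.1 (List.tail_suffix z).isInfix
  · intro w hw z
    rw [mem_factors] at hw
    constructor
    · rintro ⟨h, i, rfl⟩
      simp [h, hw.2]
    · rintro ⟨hz, rfl⟩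
      rw [mem_factors] at hz
      obtain ⟨a, z', rfl⟩ := List.exists_cons_of_length_eq_add_one hz.2
      exact ⟨hz.1, a, by simp⟩

theorem sum_ncard_Rext (u : ℕ → A) (n : ℕ) :
    #(factors u (n + 1)) = ∑ w ∈ factors u n, (Rext u w).ncard := by
  refine card_eq_sum_ncard_fiber (fun z => z.dropLast) _ ?_ ?_
  · intro z hz
    rw [mem_factors] at hz
    simpa [hz.2] using mem_language_of_infix hz.1 (List.dropLast_prefix z).isInfix
  · intro w hw z
    rw [mem_factors] at hw
    constructor
    · rintro ⟨h, i, rfl⟩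
      simp [h, hw.2]
    · rintro ⟨hz, rfl⟩
      rw [mem_factors] at hz
      rcases List.eq_nil_or_concat' z with rfl | ⟨w, b, rfl⟩
      · simp at hz
      · exact ⟨hz.1, b, by simp⟩

theorem sum_ncard_Pext (u : ℕ → A) (n : ℕ) :
    #(palFactors u (n + 2)) = ∑ w ∈ palFactors u n, (Pext u w).ncard := by
  refine card_eq_sum_ncard_fiber (fun z => z.tail.dropLast) _ ?_ ?_
  · intro z hz
    rw [mem_palFactors] at hz
    obtain ⟨a, w, b, rfl, hw⟩ := exists_eq_cons_append hz.1.2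
    simpa [hw, (palindrome_cons_append_iff.mp hz.2).2] using
      mem_language_of_infix hz.1.1 (infix_cons_append a b)
  · intro w hw z
    rw [mem_palFactors] at hw
    constructor
    · rintro ⟨h, i, rfl⟩
      simp [h, hw.1.2, palindrome_cons_append_iff, hw.2]
    · rintro ⟨hz, rfl⟩
      rw [mem_palFactors] at hz
      obtain ⟨a, w, b, rfl, -⟩ := exists_eq_cons_append hz.1.2
      obtain ⟨rfl, -⟩ := palindrome_cons_append_iff.mp hz.2
      exact ⟨hz.1.1, a, by simp⟩

/-- The sets `Bext`, `Lext` and `Rext` partition the factors of length n+2, n+1 and n+1, so the sum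
is the second difference of the factor complexity. -/
theorem sum_bilateralOrder (u : ℕ → A) (n : ℕ) :
    ∑ w ∈ factors u n, bilateralOrder u w =
      (#(factors u (n + 2)) : ℤ) - 2 * #(factors u (n + 1)) + #(factors u n) := by
  simp only [bilateralOrder, sum_add_distrib, sum_sub_distrib]
  have h1 := congrArg (Nat.cast : ℕ → ℤ) (sum_ncard_Bext u n)
  have h2 := congrArg (Nat.cast : ℕ → ℤ) (sum_ncard_Lext u n)
  have h3 := congrArg (Nat.cast : ℕ → ℤ) (sum_ncard_Rext u n)
  push_cast at h1 h2 h3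
  rw [← h1, ← h2, ← h3]
  simp
  ring

/-- Equality in the bound relating the palindromic and the factor complexity. -/
theorem card_palFactors_add (h : ∀ w ∈ language u, HasRichOrder u w) (n : ℕ) :
    (#(palFactors u n) : ℤ) + #(palFactors u (n + 1)) =
      #(factors u (n + 1)) - #(factors u n) + 2 := by
  classical
  induction n with
  | zero =>
    have h0 : factors u 0 = {[]} := by
      ext w
      simp only [mem_factors, List.length_eq_zero_iff, mem_singleton, and_iff_right_iff_imp]
      rintro rfl
      exact block_mem_language u 0 0
    have h1 : palFactors u 0 = factors u 0 := by
      refine filter_true_of_mem fun w hw => ?_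
      rw [h0, mem_singleton] at hw
      exact hw ▸ List.Palindrome.nil
    have h2 : palFactors u (0 + 1) = factors u (0 + 1) := by
      refine filter_true_of_mem fun w hw => ?_
      obtain ⟨a, rfl⟩ := List.length_eq_one_iff.mp (mem_factors.mp hw).2
      exact List.Palindrome.singleton a
    rw [h1, h2, h0, card_singleton]
    push_cast
    ring
  | succ n ih =>
    have hb := sum_bilateralOrder u n
    -- Only palindromes contribute, and their sets `Pext` partition the palindromes of length n+2.
    -- Equating this with the second difference propagates the identity from `n` to `n+1`.
    have hp : ∑ w ∈ factors u n, bilateralOrder u w =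
        (#(palFactors u (n + 2)) : ℤ) - #(palFactors u n) := by
      have : ∑ w ∈ factors u n, bilateralOrder u w =
          ∑ w ∈ palFactors u n, (((Pext u w).ncard : ℤ) - 1) := by
        rw [palFactors, sum_filter]
        refine sum_congr rfl fun w hw => ?_
        have hw' := h w (mem_factors.mp hw).1
        split_ifs with hpal
        · exact hw'.2 hpal
        · exact hw'.1 hpal
      rw [this, sum_sub_distrib, sum_ncard_Pext]
      simp
    rw [show n + 1 + 1 = n + 2 from rfl]
    linarith

end Counting

/-! ### The graph of factors up to reversal -/

section Graph

open Finset

variable {A : Type*}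

/-- The class of a word up to reversal. -/
def revClass (w : List A) : Sym2 (List A) :=
  s(w, w.reverse)

theorem revClass_eq_iff {v w : List A} : revClass v = revClass w ↔ v = w ∨ v = w.reverse := by
  simp only [revClass, Sym2.eq_iff]
  constructor
  · rintro (h | h)
    · exact Or.inl h.1
    · exact Or.inr h.1
  · rintro (rfl | rfl)
    · simp
    · simp

theorem revClass_reverse (w : List A) : revClass w.reverse = revClass w :=
  revClass_eq_iff.mpr (Or.inr rfl)

/-- The classes of the two longest proper border factors of a word. -/
def endClasses (w : List A) : Sym2 (Sym2 (List A)) :=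
  s(revClass w.dropLast, revClass w.tail)

/-- Reversal exchanges the two ends, so an edge class has a well-defined unordered pair of end
classes. -/
theorem endClasses_congr {v w : List A} (h : revClass v = revClass w) :
    endClasses v = endClasses w := by
  rcases revClass_eq_iff.mp h with rfl | rfl
  · rfl
  · rw [endClasses, List.dropLast_reverse, List.tail_reverse, revClass_reverse, revClass_reverse,
      Sym2.eq_swap, endClasses]

theorem endClasses_block (u : ℕ → A) (j n : ℕ) :
    endClasses (block u j (n + 1)) = s(revClass (block u j n), revClass (block u (j + 1) n)) := by
  rw [endClasses]
  congr 2
  · rw [block_succ, List.dropLast_concat]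
  · rw [block_succ', List.tail_cons]

theorem exists_first_difference {v w : List A} (hl : v.length = w.length) (hne : v ≠ w) :
    ∃ t a b v' w', v = t ++ a :: v' ∧ w = t ++ b :: w' ∧ a ≠ b := by
  induction v generalizing w with
  | nil =>
    cases w with
    | nil => exact absurd rfl hne
    | cons b w => simp at hl
  | cons a v ih =>
    cases w with
    | nil => simp at hl
    | cons b w =>
      by_cases hab : a = b
      · subst hab
        obtain ⟨t, c, c', v', w', h1, h2, h3⟩ := ih (by simpa using hl) (by simpa using hne)
        exact ⟨a :: t, c, c', v', w', by simp [h1], by simp [h2], h3⟩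
      · exact ⟨[], a, b, v, w, rfl, rfl, hab⟩

variable [Finite A] {u : ℕ → A}

open Classical in
/-- The classes of the factors of length `n`. -/
noncomputable def classes (u : ℕ → A) (n : ℕ) : Finset (Sym2 (List A)) :=
  (factors u n).image revClass

open Classical in
/-- The classes of the non-palindromic factors of length `n`. -/
noncomputable def nonpalClasses (u : ℕ → A) (n : ℕ) : Finset (Sym2 (List A)) :=
  {w ∈ factors u n | ¬ w.Palindrome}.image revClass

/-- A non-palindromic class has two members; a palindromic one has a single member, counted once
among the factors and once among the palindromes. -/
theorem two_mul_card_classes (hu : HasPalPrefixes u) (n : ℕ) :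
    2 * #(classes u n) = #(factors u n) + #(palFactors u n) := by
  classical
  have h1 := card_eq_sum_card_image revClass (factors u n)
  have h2 : #(palFactors u n) = ∑ c ∈ classes u n, #{w ∈ palFactors u n | revClass w = c} :=
    card_eq_sum_card_fiberwise fun w hw =>
      mem_image_of_mem _ (mem_filter.mp (show w ∈ palFactors u n from hw)).1
  rw [h1, h2, classes, ← sum_add_distrib, mul_comm, ← smul_eq_mul, ← sum_const]
  refine sum_congr rfl fun c hc => ?_
  obtain ⟨w, hw, rfl⟩ := mem_image.mp hc
  rw [mem_factors] at hw
  have hwr := hu.reverse_mem hw.1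
  have e1 : {v ∈ factors u n | revClass v = revClass w} = {w, w.reverse} := by
    ext v
    simp only [mem_filter, mem_factors, revClass_eq_iff, mem_insert, mem_singleton]
    constructor
    · exact fun h => h.2
    · rintro (rfl | rfl)
      · exact ⟨hw, Or.inl rfl⟩
      · exact ⟨⟨hwr, by simpa using hw.2⟩, Or.inr rfl⟩
  rw [e1]
  by_cases hp : w.Palindrome
  · have e2 : {v ∈ palFactors u n | revClass v = revClass w} = {w} := by
      ext v
      simp only [mem_filter, mem_palFactors, revClass_eq_iff, mem_singleton, hp.reverse_eq, or_self]
      constructor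
      · exact fun h => h.2
      · rintro rfl
        exact ⟨⟨hw, hp⟩, rfl⟩
    rw [e2, hp.reverse_eq]
    simp
  · have e2 : {v ∈ palFactors u n | revClass v = revClass w} = ∅ := by
      refine filter_false_of_mem fun v hv hc => hp ?_
      have hv' := (mem_palFactors.mp hv).2
      rcases revClass_eq_iff.mp hc with rfl | rfl
      · exact hv'
      · exact List.Palindrome.of_reverse_eq (by simpa using hv'.reverse_eq.symm)
    have hne : w ≠ w.reverse := fun h => hp (List.Palindrome.of_reverse_eq h.symm)
    rw [e2, card_pair hne]
    simp

theorem card_classes (n : ℕ) :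
    #(classes u n) = #(nonpalClasses u n) + #(palFactors u n) := by
  classical
  have hinj : Set.InjOn revClass (palFactors u n : Set (List A)) := by
    intro v hv w hw h
    have hw' := (mem_palFactors.mp (show w ∈ palFactors u n from hw)).2
    simpa [revClass_eq_iff, hw'.reverse_eq] using h
  rw [← card_image_of_injOn hinj, ← card_union_of_disjoint]
  · congr 1
    ext c
    simp only [classes, nonpalClasses, palFactors, mem_union, mem_image, mem_filter]
    constructor
    · rintro ⟨w, hw, rfl⟩
      by_cases hp : w.Palindrome
      · exact Or.inr ⟨w, ⟨hw, hp⟩, rfl⟩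
      · exact Or.inl ⟨w, ⟨hw, hp⟩, rfl⟩
    · rintro (⟨w, ⟨hw, -⟩, rfl⟩ | ⟨w, ⟨hw, -⟩, rfl⟩) <;> exact ⟨w, hw, rfl⟩
  · rw [disjoint_left]
    intro c hc hc'
    obtain ⟨v, hv, rfl⟩ := mem_image.mp hc
    obtain ⟨w, hw, h⟩ := mem_image.mp hc'
    have hw' := (mem_palFactors.mp hw).2
    have hv' := (mem_filter.mp hv).2
    rcases revClass_eq_iff.mp h with rfl | rfl
    · exact hv' hw'
    · exact hv' (List.Palindrome.of_reverse_eq (by simpa using hw'.reverse_eq.symm))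

/-- Euler's count for a tree. Twice the left-hand cardinal is C(n+1) - P(n+1), twice the right-hand
one is C(n) + P(n), and these differ by 2. -/
theorem card_nonpalClasses (hu : HasPalPrefixes u) (h : ∀ w ∈ language u, HasRichOrder u w)
    (n : ℕ) : #(nonpalClasses u (n + 1)) + 1 = #(classes u n) := by
  have h1 := card_palFactors_add h n
  have h2 := two_mul_card_classes hu n
  have h3 := two_mul_card_classes hu (n + 1)
  have h4 := card_classes (u := u) (n + 1)
  omega

theorem block_mem_factors (u : ℕ → A) (j n : ℕ) : block u j n ∈ factors u n := by
  simp [block_mem_language]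

/-- The class of the factor of length `n` at position `j`. -/
noncomputable def vertex (u : ℕ → A) (n j : ℕ) : {c // c ∈ classes u n} :=
  ⟨revClass (block u j n), by
    classical exact mem_image_of_mem _ (block_mem_factors u j n)⟩

/-- The graph of the classes of factors of length `n`; classes of consecutive factors are joined. -/
def classGraph (u : ℕ → A) (n : ℕ) : SimpleGraph {c // c ∈ classes u n} :=
  SimpleGraph.fromRel fun c c' => ∃ j, c = vertex u n j ∧ c' = vertex u n (j + 1)

theorem vertex_surjective (u : ℕ → A) (n : ℕ) : Function.Surjective (vertex u n) := by
  classical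
  rintro ⟨c, hc⟩
  obtain ⟨w, hw, rfl⟩ := mem_image.mp hc
  obtain ⟨⟨j, hj⟩, rfl⟩ := mem_factors.mp hw
  exact ⟨j, Subtype.ext (congrArg revClass hj.symm)⟩

theorem classGraph_adj (u : ℕ → A) {n j : ℕ} (h : vertex u n j ≠ vertex u n (j + 1)) :
    (classGraph u n).Adj (vertex u n j) (vertex u n (j + 1)) := by
  rw [classGraph, SimpleGraph.fromRel_adj]
  exact ⟨h, Or.inl ⟨j, rfl, rfl⟩⟩

/-- The sequence itself is a walk that visits every vertex. -/
theorem classGraph_connected (u : ℕ → A) (n : ℕ) : (classGraph u n).Connected := by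
  have h : ∀ j, (classGraph u n).Reachable (vertex u n 0) (vertex u n j) := by
    intro j
    induction j with
    | zero => exact SimpleGraph.Reachable.refl _
    | succ j ih =>
      by_cases hne : vertex u n j = vertex u n (j + 1)
      · rwa [← hne]
      · exact ih.trans (classGraph_adj u hne).reachable
  rw [SimpleGraph.connected_iff_exists_forall_reachable]
  refine ⟨vertex u n 0, fun c => ?_⟩
  obtain ⟨j, rfl⟩ := vertex_surjective u n c
  exact h j

theorem exists_of_mem_edgeSet {n : ℕ} {e : Sym2 {c // c ∈ classes u n}}
    (he : e ∈ (classGraph u n).edgeSet) :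
    ∃ j, e = s(vertex u n j, vertex u n (j + 1)) ∧ vertex u n j ≠ vertex u n (j + 1) := by
  induction e using Sym2.ind with
  | h c c' =>
    rw [SimpleGraph.mem_edgeSet, classGraph, SimpleGraph.fromRel_adj] at he
    obtain ⟨hne, ⟨j, rfl, rfl⟩ | ⟨j, rfl, rfl⟩⟩ := he
    · exact ⟨j, rfl, hne⟩
    · exact ⟨j, Sym2.eq_swap, hne.symm⟩

/-- The length-`n` prefix and suffix of a palindrome are mirror images, so palindromes yield loops,
not edges. -/
theorem vertex_eq_of_palindrome {n j : ℕ} (h : (block u j (n + 1)).Palindrome) :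
    vertex u n j = vertex u n (j + 1) := by
  refine Subtype.ext (revClass_eq_iff.mpr (Or.inr ?_))
  have h1 := congrArg List.dropLast h.reverse_eq
  rw [block_succ, List.dropLast_concat, ← block_succ, block_succ', List.reverse_cons,
    List.dropLast_concat] at h1
  exact h1.symm

theorem map_val_edge (u : ℕ → A) (n j : ℕ) :
    Sym2.map Subtype.val s(vertex u n j, vertex u n (j + 1)) =
      endClasses (block u j (n + 1)) := by
  rw [endClasses_block]
  rfl

/-- If there is one class of vertices more than classes of edges, then the graph is a tree, whose
edges are the classes of the non-palindromic factors. -/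
theorem classGraph_isTree {n : ℕ} (h : #(nonpalClasses u (n + 1)) + 1 = #(classes u n)) :
    (classGraph u n).IsTree ∧
      (∀ j, ¬ (block u j (n + 1)).Palindrome → vertex u n j ≠ vertex u n (j + 1)) ∧
      ∀ j k, ¬ (block u j (n + 1)).Palindrome → ¬ (block u k (n + 1)).Palindrome →
        s(vertex u n j, vertex u n (j + 1)) = s(vertex u n k, vertex u n (k + 1)) →
        revClass (block u j (n + 1)) = revClass (block u k (n + 1)) := by
  classical
  have hconn := classGraph_connected u n
  have hV : Nat.card {c // c ∈ classes u n} = #(classes u n) := by simp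
  choose pos hpos hne using fun e : (classGraph u n).edgeSet => exists_of_mem_edgeSet e.2
  -- Each edge is sent to a class of words producing it. The map is injective because a class
  -- determines its ends. Connectedness needs at least #V - 1 edges, which is the size of the
  -- target, so `ψ` is bijective.
  let ψ : (classGraph u n).edgeSet → {c // c ∈ nonpalClasses u (n + 1)} := fun e =>
    ⟨revClass (block u (pos e) (n + 1)), mem_image_of_mem _ (mem_filter.mpr
      ⟨block_mem_factors _ _ _, fun hp => hne e (vertex_eq_of_palindrome hp)⟩)⟩
  have hends : ∀ e j, revClass (block u j (n + 1)) = (ψ e).1 →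
      s(vertex u n j, vertex u n (j + 1)) = e.1 := by
    intro e j hj
    have := endClasses_congr hj
    rw [← map_val_edge, ← map_val_edge] at this
    rw [hpos e]
    exact Sym2.map.injective Subtype.val_injective this
  have hinj : Function.Injective ψ := by
    intro e e' hee
    refine Subtype.ext ?_
    rw [← hends e (pos e) rfl, ← hends e' (pos e) (congrArg Subtype.val hee)]
  have hle := hconn.card_vert_le_card_edgeSet_add_one
  have hge := Nat.card_le_card_of_injective ψ hinj
  have hN : Nat.card {c // c ∈ nonpalClasses u (n + 1)} = #(nonpalClasses u (n + 1)) := by simp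
  have hbij : Function.Bijective ψ :=
    (Nat.bijective_iff_injective_and_card ψ).mpr ⟨hinj, by omega⟩
  have hsurj : ∀ j, ¬ (block u j (n + 1)).Palindrome →
      ∃ e, revClass (block u j (n + 1)) = (ψ e).1 := by
    intro j hj
    obtain ⟨e, he⟩ := hbij.2 ⟨revClass (block u j (n + 1)), mem_image_of_mem _
      (mem_filter.mpr ⟨block_mem_factors _ _ _, hj⟩)⟩
    exact ⟨e, by rw [he]⟩
  refine ⟨SimpleGraph.isTree_iff_connected_and_card.mpr ⟨hconn, by omega⟩, ?_, ?_⟩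
  · intro j hj
    obtain ⟨e, he⟩ := hsurj j hj
    have hmem := hends e j he ▸ e.2
    exact ((classGraph u n).mem_edgeSet.mp hmem).ne
  · intro j k hj hk hjk
    obtain ⟨e, he⟩ := hsurj j hj
    obtain ⟨e', he'⟩ := hsurj k hk
    rw [he, he']
    rw [hends e j he, hends e' k he'] at hjk
    rw [Subtype.ext hjk]

/-- A walk along the sequence that returns to a class for the first time does so through the edge
by which it has left. -/
theorem palindrome_or_revClass_eq {n : ℕ} (h : #(nonpalClasses u (n + 1)) + 1 = #(classes u n))
    {j m : ℕ} (hm : vertex u n (j + m + 1) = vertex u n j)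
    (hint : ∀ i < m, vertex u n (j + i + 1) ≠ vertex u n j) :
    (block u j (n + 1)).Palindrome ∨
      revClass (block u j (n + 1)) = revClass (block u (j + m) (n + 1)) := by
  by_contra! hc
  obtain ⟨hp, hcl⟩ := hc
  obtain ⟨htree, hloop, hsimple⟩ := classGraph_isTree h
  have hne := hloop j hp
  have hadj := classGraph_adj u hne
  have hbr := SimpleGraph.isBridge_iff.mp
    (SimpleGraph.isAcyclic_iff_forall_adj_isBridge.mp htree.isAcyclic hadj)
  obtain ⟨m, rfl⟩ : ∃ k, m = k + 1 := by
    cases m with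
    | zero => exact absurd hm.symm hne
    | succ k => exact ⟨k, rfl⟩
  -- Before its return the walk avoids the starting vertex, hence never uses the first edge.
  have hreach : ∀ i ≤ m, ((classGraph u n).deleteEdges
      {s(vertex u n j, vertex u n (j + 1))}).Reachable (vertex u n (j + 1))
        (vertex u n (j + i + 1)) := by
    intro i
    induction i with
    | zero => exact fun _ => SimpleGraph.Reachable.refl _
    | succ i ih =>
      intro hi
      have ih' := ih (by omega)
      have h1 := hint i (by omega)
      have h2 := hint (i + 1) (by omega)
      rw [← add_assoc] at h2 ⊢
      by_cases he : vertex u n (j + i + 1) = vertex u n (j + i + 1 + 1)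
      · rwa [← he]
      · refine ih'.trans (SimpleGraph.Adj.reachable ?_)
        rw [SimpleGraph.deleteEdges_adj]
        refine ⟨classGraph_adj u he, ?_⟩
        rw [Set.mem_singleton_iff, Sym2.eq_iff]
        rintro (h' | h')
        · exact h1 h'.1
        · exact h2 h'.2
  -- The closing edge comes from another class, hence differs from the first edge. The two ends of
  -- the first edge thus stay connected after its deletion, although it is a bridge.
  have hlast := hint m (by omega)
  rw [← add_assoc] at hm hcl
  refine hbr (SimpleGraph.Reachable.symm ((hreach m le_rfl).trans (SimpleGraph.Adj.reachable ?_)))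
  rw [SimpleGraph.deleteEdges_adj, ← hm]
  have hne' : vertex u n (j + m + 1) ≠ vertex u n (j + m + 1 + 1) := by rwa [hm]
  refine ⟨classGraph_adj u hne', fun he => hcl ?_⟩
  refine hsimple _ _ hp (fun hp' => hne' (vertex_eq_of_palindrome hp')) ?_
  rw [Set.mem_singleton_iff, hm] at he
  rw [hm, he]

/-- Complete returns to palindromes are palindromes. -/
theorem palindrome_of_return (hu : HasPalPrefixes u) (h : ∀ w ∈ language u, HasRichOrder u w)
    (v z : List A) (hv : v.Palindrome) (hz : z ∈ language u) (hpre : v <+: z) (hsuf : v <:+ z)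
    (hocc : ∀ j, OccursAt v z j → j = 0 ∨ j + v.length = z.length) : z.Palindrome := by
  by_contra hnp
  have hne : z ≠ z.reverse := fun e => hnp (List.Palindrome.of_reverse_eq e.symm)
  -- Here `t` is the longest common prefix of `z` and its reverse. Both begin with `v`, so `t` does
  -- too.
  obtain ⟨t, a, b, z1, z2, h1, h2, hab⟩ := exists_first_difference (by simp) hne
  have hpre' : v <+: z.reverse := by
    rw [← hv.reverse_eq]
    exact List.reverse_prefix.mpr hsuf
  have hta : t ++ [a] <+: z := ⟨z1, by simp [h1]⟩
  have htb : t ++ [b] <+: z.reverse := ⟨z2, by simp [h2]⟩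
  have hvt : v.length ≤ t.length := by
    by_contra! hlt
    have e1 := List.prefix_of_prefix_length_le hta hpre (by simpa using hlt)
    have e2 := List.prefix_of_prefix_length_le htb hpre' (by simpa using hlt)
    have := (List.prefix_of_prefix_length_le e1 e2 (by simp)).eq_of_length (by simp)
    exact hab (by simpa using this)
  have hvt' : v <+: t := List.prefix_of_prefix_length_le hpre ⟨_, h1.symm⟩ hvt
  obtain ⟨j, hj⟩ := hz
  have hlen : z.length = t.length + 1 + z1.length := by
    rw [h1]
    simp
    omega
  have hlen' : z2.length = z1.length := by
    have := congrArg List.length h2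
    simp at this
    omega
  have hblock1 : block u j (t.length + 1) = t ++ [a] := by
    have e : block u j z.length = [] ++ (t ++ [a]) ++ z1 := by
      rw [← hj, h1]
      simp
    simpa using (eq_block_of_append_eq e).2.1.symm
  -- Inside `z` the walk goes from the vertex of `t` to that of its reverse, the same vertex. It
  -- leaves by `t ++ [a]` and comes back by `b :: t.reverse`.
  have hblock2 : block u (j + z1.length) (t.length + 1) = b :: t.reverse := by
    have e : block u j z.length = z2.reverse ++ (b :: t.reverse) ++ [] := by
      rw [← hj, ← List.reverse_reverse z, h2]
      simp
    have := (eq_block_of_append_eq e).2.1.symm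
    simpa [hlen'] using this
  have hblock1' : block u j t.length = t := by
    rw [block_succ] at hblock1
    exact (List.append_inj hblock1 (by simp)).1
  have hblock2' : block u (j + z1.length + 1) t.length = t.reverse := by
    rw [block_succ'] at hblock2
    exact (List.cons.inj hblock2).2
  have hoccurs : ∀ k, k + v.length ≤ z.length → block u (j + k) v.length = v →
      OccursAt v z k := by
    intro k hk hbk
    obtain ⟨r, hr⟩ := Nat.exists_eq_add_of_le hk
    refine ⟨block u j k, block u (j + (k + v.length)) r, ?_, by simp⟩
    rw [hr, block_add, block_add, hbk] at hj
    exact hj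
  -- An earlier return would exhibit `v`, as a prefix of `t` or a suffix of `t.reverse`, at a
  -- forbidden place in `z`.
  have hint : ∀ i < z1.length, vertex u t.length (j + i + 1) ≠ vertex u t.length j := by
    intro i hi he
    have he' : revClass (block u (j + i + 1) t.length) = revClass (block u j t.length) :=
      congrArg Subtype.val he
    rw [hblock1'] at he'
    rcases revClass_eq_iff.mp he' with e | e
    · obtain ⟨r, hr⟩ := hvt'
      have e' : block u (j + i + 1) t.length = [] ++ v ++ r := by rw [e, List.nil_append, hr]
      have := (eq_block_of_append_eq e').2.1
      have := hocc (i + 1) (hoccurs _ (by omega) (by simpa [← add_assoc] using this.symm))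
      omega
    · obtain ⟨r, hr⟩ := hvt'
      have e' : block u (j + i + 1) t.length = r.reverse ++ v ++ [] := by
        rw [e, List.append_nil, ← hr, List.reverse_append, hv.reverse_eq]
      have := (eq_block_of_append_eq e').2.1
      have hr' : v.length + r.length = t.length := by rw [← hr, List.length_append]
      have := hocc (i + 1 + r.length)
        (hoccurs _ (by omega) (by simpa [← add_assoc] using this.symm))
      omega
  rcases palindrome_or_revClass_eq (card_nonpalClasses hu h t.length) (m := z1.length)
    (Subtype.ext (by
      change revClass (block u (j + z1.length + 1) t.length) = revClass (block u j t.length)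
      rw [hblock1', hblock2', revClass_reverse])) hint with hp | hc
  · rcases Nat.eq_zero_or_pos z1.length with h0 | h0
    · rw [List.length_eq_zero_iff] at h0
      rw [hblock1] at hp
      rw [h1, h0] at hnp
      exact hnp hp
    · exact hint 0 h0 (vertex_eq_of_palindrome hp).symm
  -- Leaving and coming back by the same edge class forces `a = b`.
  · rw [hblock1, hblock2] at hc
    rcases revClass_eq_iff.mp hc with e | e
    · have e' := congrArg List.reverse e
      cases t with
      | nil => exact hab (by simpa using e)
      | cons c t =>
        have hcb : c = b := by simpa using congrArg List.head? e
        have hac : a = c := by simpa using congrArg List.head? e'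
        exact hab (hac.trans hcb)
    · exact hab (by simpa using e)

/-- A sequence with arbitrarily long palindromic prefixes is rich if all its bispecial factors have
the prescribed bilateral order. -/
theorem isRich_of_bispecial (hu : HasPalPrefixes u)
    (h : ∀ w, IsBispecial u w → HasRichOrder u w) : IsRich u := by
  have h' : ∀ w ∈ language u, HasRichOrder u w := by
    intro w hw
    by_cases hb : IsBispecial u w
    · exact h w hb
    · exact hu.hasRichOrder_of_not_bispecial hw hb
  exact isRich_of_palindromic_returns (palindrome_of_return hu h')

end Graph

/-! ### Images of sequences under morphisms -/

section Images

variable {A B : Type*} {η : A → List B}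

theorem onWord_append (η : A → List B) (x y : List A) :
    onWord η (x ++ y) = onWord η x ++ onWord η y := by
  simp [onWord]

theorem onWord_cons (η : A → List B) (a : A) (x : List A) :
    onWord η (a :: x) = η a ++ onWord η x := by
  simp [onWord]

theorem onWord_singleton (η : A → List B) (a : A) : onWord η [a] = η a := by
  simp [onWord]

/-- The position in the image at which the image of the `k`-th letter starts. -/
def cut (η : A → List B) (u : ℕ → A) (k : ℕ) : ℕ :=
  (onWord η (block u 0 k)).length

theorem cut_add (η : A → List B) (u : ℕ → A) (k n : ℕ) :
    cut η u (k + n) = cut η u k + (onWord η (block u k n)).length := by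
  simp [cut, block_add, onWord_append]

theorem cut_zero (η : A → List B) (u : ℕ → A) : cut η u 0 = 0 := by
  simp [cut, onWord]

theorem cut_succ (η : A → List B) (u : ℕ → A) (k : ℕ) :
    cut η u (k + 1) = cut η u k + (η (u k)).length := by
  rw [cut_add, block_one, onWord_singleton]

variable (h : ∀ a, η a ≠ [])

theorem cut_strictMono (h : ∀ a, η a ≠ []) (u : ℕ → A) : StrictMono (cut η u) := by
  refine strictMono_nat_of_lt_succ fun k => ?_
  have := List.length_pos_iff.mpr (h (u k))
  rw [cut_succ]
  omega

theorem exists_cut_le (h : ∀ a, η a ≠ []) (u : ℕ → A) (m : ℕ) :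
    ∃ k r, m = cut η u k + r ∧ r < (η (u k)).length := by
  induction m with
  | zero => exact ⟨0, 0, by simp [cut_zero], List.length_pos_iff.mpr (h _)⟩
  | succ m ih =>
    obtain ⟨k, r, hm, hr⟩ := ih
    by_cases hr' : r + 1 < (η (u k)).length
    · exact ⟨k, r + 1, by omega, hr'⟩
    · exact ⟨k + 1, 0, by rw [cut_succ]; omega, List.length_pos_iff.mpr (h _)⟩

theorem block_onSeq_zero (u : ℕ → A) (k : ℕ) :
    block (onSeq η h u) 0 (cut η u k) = onWord η (block u 0 k) := by
  refine List.ext_getElem (by simp [cut]) fun n h1 h2 => ?_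
  simp only [getElem_block, zero_add, onSeq]
  rcases le_total (n + 1) k with hk | hk
  · obtain ⟨r, rfl⟩ := Nat.exists_eq_add_of_le hk
    refine (onWord_prefix η ?_).getElem _
    exact ⟨block u (0 + (n + 1)) r, (block_add u 0 (n + 1) r).symm⟩
  · obtain ⟨r, hr⟩ := Nat.exists_eq_add_of_le hk
    refine ((onWord_prefix η ?_).getElem h2).symm
    rw [hr]
    exact ⟨block u (0 + k) r, (block_add u 0 k r).symm⟩

theorem block_onSeq (u : ℕ → A) (k n : ℕ) :
    block (onSeq η h u) (cut η u k) (onWord η (block u k n)).length =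
      onWord η (block u k n) := by
  have h1 := block_onSeq_zero h u (k + n)
  rw [cut_add, block_add, block_add, onWord_append, zero_add, zero_add] at h1
  exact (List.append_inj h1 (by simp [cut])).2

theorem block_onSeq_letter (u : ℕ → A) (k : ℕ) :
    block (onSeq η h u) (cut η u k) (η (u k)).length = η (u k) := by
  have := block_onSeq h u k 1
  rwa [block_one, onWord_singleton] at this

end Images

/-! ### Desubstitution -/

section Desubstitution

variable {A B : Type*} {η : A → List B} {p : List B}

namespace IsClassPret

variable (hη : IsClassPret η p)

theorem prefix_image (hη : IsClassPret η p) (i : A) : p <+: η i := by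
  obtain ⟨q, -, hq⟩ := hη.eq_append i
  exact ⟨q, hq.symm⟩

theorem reverse_image_append (hη : IsClassPret η p) (i : A) : (η i ++ p).reverse = η i ++ p := by
  obtain ⟨q, hq, h⟩ := hη.eq_append i
  simp [h, hq.reverse_eq, hη.palindrome.reverse_eq]

/-- Each η(a)p = p q p is a palindrome, so reversal carries `p` across the images one letter at a
time. -/
theorem reverse_onWord_append (hη : IsClassPret η p) (x : List A) :
    (onWord η x ++ p).reverse = onWord η x.reverse ++ p := by
  induction x with
  | nil => simpa [onWord] using hη.palindrome.reverse_eq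
  | cons a x ih =>
    have h := hη.reverse_image_append a
    rw [List.reverse_append, hη.palindrome.reverse_eq] at h
    rw [onWord_cons, List.append_assoc, List.reverse_append, ih, List.reverse_cons, onWord_append,
      onWord_singleton, List.append_assoc, h, List.append_assoc]

/-- The image of the next letter begins with `p`. -/
theorem block_onSeq_append (u : ℕ → A) (k n : ℕ) :
    block (onSeq η hη.ne_nil u) (cut η u k) ((onWord η (block u k n)).length + p.length) =
      onWord η (block u k n) ++ p := by
  obtain ⟨q, hq⟩ := hη.prefix_image (u (k + n))
  have h1 := block_onSeq_letter hη.ne_nil u (k + n)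
  rw [← hq, List.length_append, block_add] at h1
  rw [block_add, block_onSeq, ← cut_add, (List.append_inj h1 (by simp)).1]

theorem hasPalPrefixes_onSeq {u : ℕ → A} (hu : HasPalPrefixes u) :
    HasPalPrefixes (onSeq η hη.ne_nil u) := by
  intro N
  obtain ⟨n, hn, hp⟩ := hu N
  refine ⟨(onWord η (block u 0 n)).length + p.length, ?_, ?_⟩
  · have := le_length_onWord η 1 (fun a => List.length_pos_iff.mpr (hη.ne_nil a)) (block u 0 n)
    rw [length_block] at this
    omega
  · have := hη.block_onSeq_append u 0 n
    rw [cut_zero] at this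
    rw [this]
    refine List.Palindrome.of_reverse_eq ?_
    rw [hη.reverse_onWord_append, hp.reverse_eq]

theorem block_cut (u : ℕ → A) (k : ℕ) :
    block (onSeq η hη.ne_nil u) (cut η u k) p.length = p := by
  simpa [onWord] using hη.block_onSeq_append u k 0

/-- The common palindrome occurs in the image only where the image of a letter starts. -/
theorem exists_cut_eq {u : ℕ → A} {m : ℕ}
    (hm : block (onSeq η hη.ne_nil u) m p.length = p) : ∃ k, m = cut η u k := by
  obtain ⟨k, r, rfl, hr⟩ := exists_cut_le hη.ne_nil u m
  obtain ⟨r', -, hr', hocc⟩ := hη.completeReturn (u k)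
  have hr'' := List.append_cancel_right hr'
  have hb := hη.block_onSeq_append u k 1
  rw [block_one, onWord_singleton] at hb
  obtain ⟨e, he⟩ := Nat.exists_eq_add_of_lt hr
  have hlen : (η (u k)).length + p.length = r + p.length + (e + 1) := by omega
  rw [hlen, block_add, block_add, hm] at hb
  -- As `r` is less than the length of the image, this occurrence of `p` lies inside η(u k)p, where
  -- only offset 0 is left.
  rcases (hocc r).mp ⟨_, _, hb.symm, by simp⟩ with h0 | h0
  · exact ⟨k, by omega⟩
  · rw [← hr''] at h0
    omega

/-- Reflection in the palindrome η(j)p. It turns the condition on a right extension, read after the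
last `p`, into one on the end of η(j). -/
theorem suffix_image_iff (hη : IsClassPret η p) {t : List B} {b : B} {j : A} :
    b :: t <:+ η j ↔ p ++ t.reverse ++ [b] <+: η j ++ p := by
  have h1 : p ++ t.reverse ++ [b] = ((b :: t) ++ p).reverse := by
    simp [hη.palindrome.reverse_eq]
  rw [h1]
  nth_rw 1 [← hη.reverse_image_append j]
  rw [List.reverse_prefix]
  constructor
  · rintro ⟨q, hq⟩
    exact ⟨q, by rw [← hq, List.append_assoc]⟩
  · rintro ⟨q, hq⟩
    rw [← List.append_assoc] at hq
    exact ⟨q, List.append_cancel_right hq⟩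

end IsClassPret

theorem exists_first_occurrence {p w : List B} (h : p <:+: w) :
    ∃ s y, w = s ++ p ++ y ∧ ∀ s' y', w = s' ++ p ++ y' → s.length ≤ s'.length := by
  classical
  have hex : ∃ n, ∃ s y : List B, w = s ++ p ++ y ∧ s.length = n := by
    obtain ⟨s, y, e⟩ := h
    exact ⟨_, s, y, e.symm, rfl⟩
  obtain ⟨s, y, hw, hs⟩ := Nat.find_spec hex
  exact ⟨s, y, hw, fun s' y' h' => hs ▸ Nat.find_min' hex ⟨s', y', h', rfl⟩⟩

theorem exists_last_occurrence {p w : List B} (h : p <:+: w) :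
    ∃ y t, w = y ++ p ++ t ∧ ∀ y' t', w = y' ++ p ++ t' → t.length ≤ t'.length := by
  classical
  have hex : ∃ n, ∃ y t : List B, w = y ++ p ++ t ∧ t.length = n := by
    obtain ⟨y, t, e⟩ := h
    exact ⟨_, y, t, e.symm, rfl⟩
  obtain ⟨y, t, hw, ht⟩ := Nat.find_spec hex
  exact ⟨y, t, hw, fun y' t' heq => ht ▸ Nat.find_min' hex ⟨y', t', heq, rfl⟩⟩

/-- A factor of the image that contains the common palindrome is `s η(x) p tᴿ` for some factor `x`
of the preimage, and its extensions are determined by those of `x`. -/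
theorem IsClassPret.desubstitute (hη : IsClassPret η p) (u : ℕ → A) {w : List B}
    (hw : w ∈ language (onSeq η hη.ne_nil u)) (hpw : p <:+: w) :
    ∃ s x t, w = s ++ onWord η x ++ p ++ t.reverse ∧
      (∀ a b, Ext (onSeq η hη.ne_nil u) w a b ↔
        ∃ i j, Ext u x i j ∧ a :: s <:+ η i ∧ b :: t <:+ η j) ∧
      (w.Palindrome ↔ x.Palindrome ∧ s = t) := by
  set v := onSeq η hη.ne_nil u with hv
  have hmono := cut_strictMono hη.ne_nil u
  -- Cut `w` before its first and after its last occurrence of `p`; the two may coincide or overlap.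
  obtain ⟨s, y₁, hs, hsmin⟩ := exists_first_occurrence hpw
  obtain ⟨y, t, ht, htmin⟩ := exists_last_occurrence hpw
  have hsy := hsmin _ _ ht
  have hlen : w.length = y.length + p.length + t.length := by simp [ht, add_assoc]
  -- Wherever `w` occurs, both occurrences of `p` start at cuts, so the stretch between these cuts
  -- is the image of a block.
  have key : ∀ m, block v m w.length = w → ∃ k n, cut η u k = m + s.length ∧
      cut η u (k + n) = m + y.length ∧ w = s ++ onWord η (block u k n) ++ p ++ t := by
    intro m hm
    obtain ⟨es, ep, -⟩ := eq_block_of_append_eq (hm.trans hs)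
    obtain ⟨-, ep', et⟩ := eq_block_of_append_eq (hm.trans ht)
    obtain ⟨k, hk⟩ := hη.exists_cut_eq ep.symm
    obtain ⟨k', hk'⟩ := hη.exists_cut_eq ep'.symm
    have hkk : cut η u k ≤ cut η u k' := by omega
    obtain ⟨n, rfl⟩ := Nat.exists_eq_add_of_le (hmono.le_iff_le.mp hkk)
    refine ⟨k, n, hk.symm, hk'.symm, ?_⟩
    have hM := cut_add η u k n
    have hb := hη.block_onSeq_append u k n
    rw [← hv, ← hk] at hb
    have hl : w.length =
        s.length + ((onWord η (block u k n)).length + p.length) + t.length := by omega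
    rw [← hm, hl, block_add, block_add, ← es, hb,
      show m + (s.length + ((onWord η (block u k n)).length + p.length)) =
        m + y.length + p.length by omega, ← et]
    simp
  obtain ⟨m₀, hm₀⟩ := hw
  obtain ⟨k₀, n₀, -, -, hx⟩ := key m₀ hm₀.symm
  generalize block u k₀ n₀ = x at hx
  refine ⟨s, x, t.reverse, by simpa using hx, ?_, ?_⟩
  · intro a b
    constructor
    · rintro ⟨m, hm⟩
      have hm' : block v m (w.length + 2) = [a] ++ w ++ [b] := by
        simpa using hm.symm
      obtain ⟨ea, ew, eb⟩ := eq_block_of_append_eq hm'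
      simp only [List.length_singleton] at ea ew eb
      obtain ⟨k, n, hk, hkn, hx'⟩ := key _ ew.symm
      -- Injectivity of η makes the preimage independent of the occurrence.
      have hxx : block u k n = x := by
        rw [hx] at hx'
        simp only [List.append_assoc, List.append_cancel_left_eq] at hx'
        exact hη.injective (List.append_cancel_right hx').symm
      obtain ⟨k, rfl⟩ : ∃ l, k = l + 1 := by
        cases k with
        | zero => rw [cut_zero] at hk; omega
        | succ l => exact ⟨l, rfl⟩
      have hc := cut_succ η u k
      have hc' := cut_succ η u (k + 1 + n)
      obtain ⟨es, -, -⟩ := eq_block_of_append_eq (ew.symm.trans hs)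
      obtain ⟨-, ep, et⟩ := eq_block_of_append_eq (ew.symm.trans ht)
      refine ⟨u k, u (k + 1 + n), ?_, ?_, ?_⟩
      · have : u k :: (x ++ [u (k + 1 + n)]) = block u k (n + 2) := by
          rw [← hxx, ← block_succ, ← block_succ']
        rw [Ext, this]
        exact block_mem_language _ _ _
      -- Otherwise the `p` that starts η(u k) would lie in `w` before the first occurrence.
      · have hlt : s.length < (η (u k)).length := by
          by_contra! hle
          obtain ⟨e, he⟩ := Nat.exists_eq_add_of_le hle
          have hl : w.length = e + p.length + (w.length - e - p.length) := by omega
          have hcut : cut η u k = m + 1 + e := by omega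
          have hb := ew
          rw [hl, block_add, block_add, ← hcut, hη.block_cut] at hb
          have := hsmin _ _ hb
          rw [length_block] at this
          have := List.length_pos_iff.mpr (hη.ne_nil (u k))
          omega
        obtain ⟨e, he⟩ := Nat.exists_eq_add_of_lt hlt
        have hb := block_onSeq_letter hη.ne_nil u k
        have hcut : cut η u k + e = m := by omega
        rw [show (η (u k)).length = e + (s.length + 1) by omega, block_add, hcut, add_comm s.length,
          block_add, ← hv, ← ea, ← es] at hb
        exact ⟨_, hb⟩
      · rw [hη.suffix_image_iff, List.reverse_reverse]
        -- Otherwise the `p` at the next cut would lie in `w` after the last occurrence.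
        have hlt : t.length < (η (u (k + 1 + n))).length := by
          by_contra! hle
          obtain ⟨e, he⟩ := Nat.exists_eq_add_of_le hle
          have hl : w.length = (y.length + (η (u (k + 1 + n))).length) + p.length + e := by omega
          have hcut : cut η u (k + 1 + n + 1) =
              m + 1 + (y.length + (η (u (k + 1 + n))).length) := by omega
          have hb := ew
          rw [hl, block_add, block_add, ← hcut, hη.block_cut] at hb
          have := htmin _ _ hb
          rw [length_block] at this
          have := List.length_pos_iff.mpr (hη.ne_nil (u (k + 1 + n)))
          omega
        obtain ⟨e, he⟩ := Nat.exists_eq_add_of_lt hlt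
        have hb := hη.block_onSeq_append u (k + 1 + n) 1
        rw [block_one, onWord_singleton] at hb
        rw [← hv, hkn, show (η (u (k + 1 + n))).length + p.length =
          p.length + t.length + 1 + e by omega, block_add, block_add, block_add, ← ep,
          show m + 1 + y.length + (p.length + t.length) = m + (1 + w.length) by omega,
          ← add_assoc, ← add_assoc, ← et, ← eb] at hb
        exact ⟨_, hb⟩
    · rintro ⟨i, j, hij, ⟨q, hq⟩, hj⟩
      rw [hη.suffix_image_iff, List.reverse_reverse] at hj
      obtain ⟨q', hq'⟩ := hj
      obtain ⟨k, hk⟩ := hij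
      have hb := hη.block_onSeq_append u k (i :: (x ++ [j])).length
      rw [← hk] at hb
      refine mem_language_of_infix (hb ▸ block_mem_language _ _ _) ⟨q, q', ?_⟩
      rw [onWord_cons, onWord_append, onWord_singleton, List.append_assoc,
        List.append_assoc, List.append_assoc (onWord η x), ← hq, ← hq', hx]
      simp
  · have hrev : w.reverse = t.reverse ++ onWord η x.reverse ++ p ++ s.reverse := by
      have := hη.reverse_onWord_append x
      rw [hx, List.reverse_append, List.append_assoc, List.reverse_append, this]
      simp
    constructor
    · intro hwp
      -- Reflection of a palindrome exchanges the first and last occurrences of `p`, so both outer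
      -- pieces have the same length.
      have h1 : w = t.reverse ++ p ++ y.reverse := by
        rw [← hwp.reverse_eq, ht]
        simp [hη.palindrome.reverse_eq]
      have h2 : w = y₁.reverse ++ p ++ s.reverse := by
        rw [← hwp.reverse_eq, hs]
        simp [hη.palindrome.reverse_eq]
      have l1 := hsmin _ _ h1
      have l2 := htmin _ _ h2
      rw [List.length_reverse] at l1 l2
      rw [hwp.reverse_eq, hx] at hrev
      simp only [List.append_assoc] at hrev
      obtain ⟨e1, e2⟩ := List.append_inj hrev (by rw [List.length_reverse]; omega)
      have e3 : s.reverse = t := by rw [e1, List.reverse_reverse]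
      rw [e3] at e2
      have e4 := hη.injective (List.append_cancel_right e2)
      exact ⟨List.Palindrome.of_reverse_eq e4.symm, e1⟩
    · rintro ⟨hxp, e⟩
      refine List.Palindrome.of_reverse_eq ?_
      rw [hrev, hxp.reverse_eq, hx, ← e, e, List.reverse_reverse]

end Desubstitution

/-! ### Stars and double stars -/

section Stars

variable {A B : Type*}

/-- A symmetric relation whose graph is a star with centre `k` and leaves `J`, together with
loops at the set `Λ` that contains one leaf at most. -/
def IsStarAt (r : A → A → Prop) (k : A) (J Λ : Set A) : Prop :=
  k ∉ J ∧ (∀ i ∈ Λ, i = k ∨ i ∈ J) ∧ (∀ i ∈ Λ, ∀ j ∈ Λ, i ≠ k → j ≠ k → i = j) ∧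
    ∀ i j, r i j ↔ (i = k ∧ j ∈ J) ∨ (i ∈ J ∧ j = k) ∨ (i = j ∧ i ∈ Λ)

/-- A relation that is a star with some centre. -/
def IsStar (r : A → A → Prop) : Prop :=
  ∃ k J Λ, IsStarAt r k J Λ

/-- A relation whose bipartite graph consists of two stars with adjacent centres `k` and `m`. -/
def IsDoubleStar (r : A → A → Prop) : Prop :=
  ∃ (k m : A) (I J : Set A), k ∈ I ∧ m ∈ J ∧
    ∀ i j, r i j ↔ (i = k ∧ j ∈ J) ∨ (i ∈ I ∧ j = m)

theorem IsStar.symm {r : A → A → Prop} (h : IsStar r) {i j : A} (hij : r i j) : r j i := by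
  obtain ⟨k, J, Λ, -, -, -, hr⟩ := h
  rw [hr] at hij ⊢
  rcases hij with h | h | ⟨rfl, h⟩
  · exact Or.inr (Or.inl h.symm)
  · exact Or.inl h.symm
  · exact Or.inr (Or.inr ⟨rfl, h⟩)

theorem IsDoubleStar.flip {r : A → A → Prop} (h : IsDoubleStar r) :
    IsDoubleStar (_root_.flip r) := by
  obtain ⟨k, m, I, J, hk, hm, hr⟩ := h
  refine ⟨m, k, J, I, hm, hk, fun i j => ?_⟩
  have := hr j i
  simp only [_root_.flip]
  tauto

/-- The order is 2|J| + |Λ| - 2(|J| + 1) + 1 = |Λ| - 1, and Λ is the set of palindromic extensions.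
Specialness excludes J = ∅. -/
theorem IsStar.relOrder_eq [Finite A] {r : A → A → Prop} (h : IsStar r) (hs : RelSpecial r) :
    relOrder r = ({a | r a a}.ncard : ℤ) - 1 := by
  have hsymm : ∀ {i j}, r i j → r j i := h.symm
  obtain ⟨k, J, Λ, hkJ, hΛ, -, hr⟩ := h
  obtain ⟨j₀, hj₀⟩ : J.Nonempty := by
    by_contra hJ
    rw [Set.not_nonempty_iff_eq_empty] at hJ
    have : ∀ a b, r a b → a = k := by
      intro a b hab
      rw [hr] at hab
      rcases hab with h | h | ⟨-, h⟩
      · exact h.1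
      · simp [hJ] at h
      · simpa [hJ] using hΛ a h
    obtain ⟨a, a', hne, ⟨b, hb⟩, ⟨b', hb'⟩⟩ := hs
    exact hne ((this a b hb).trans (this a' b' hb').symm)
  have hL : {a | ∃ b, r a b} = insert k J := by
    ext a
    simp only [Set.mem_ofPred_eq, Set.mem_insert_iff, hr]
    constructor
    · rintro ⟨b, h | h | ⟨-, h⟩⟩
      · exact Or.inl h.1
      · exact Or.inr h.1
      · exact hΛ a h
    · rintro (rfl | h)
      · exact ⟨j₀, Or.inl ⟨rfl, hj₀⟩⟩
      · exact ⟨k, Or.inr (Or.inl ⟨h, rfl⟩)⟩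
  have hR : {b | ∃ a, r a b} = insert k J := by
    rw [← hL]
    ext b
    exact ⟨fun ⟨a, h⟩ => ⟨a, hsymm h⟩, fun ⟨a, h⟩ => ⟨a, hsymm h⟩⟩
  have hP : {a | r a a} = Λ := by
    ext a
    rw [Set.mem_ofPred_eq, hr]
    constructor
    · rintro (⟨rfl, h⟩ | ⟨h, rfl⟩ | ⟨-, h⟩)
      · exact absurd h hkJ
      · exact absurd h hkJ
      · exact h
    · exact fun h => Or.inr (Or.inr ⟨rfl, h⟩)
  have hB : {q : A × A | r q.1 q.2} =
      (Prod.mk k '' J ∪ (fun j => (j, k)) '' J) ∪ (fun j => (j, j)) '' Λ := by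
    ext ⟨a, b⟩
    simp only [Set.mem_ofPred_eq, hr, Set.mem_union, Set.mem_image, Prod.mk.injEq]
    constructor
    · rintro (⟨rfl, h⟩ | ⟨h, rfl⟩ | ⟨rfl, h⟩)
      · exact Or.inl (Or.inl ⟨b, h, rfl, rfl⟩)
      · exact Or.inl (Or.inr ⟨a, h, rfl, rfl⟩)
      · exact Or.inr ⟨a, h, rfl, rfl⟩
    · rintro ((⟨j, h, rfl, rfl⟩ | ⟨j, h, rfl, rfl⟩) | ⟨j, h, rfl, rfl⟩)
      · exact Or.inl ⟨rfl, h⟩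
      · exact Or.inr (Or.inl ⟨h, rfl⟩)
      · exact Or.inr (Or.inr ⟨rfl, h⟩)
  have hd1 : Disjoint (Prod.mk k '' J) ((fun j => (j, k)) '' J) := by
    rw [Set.disjoint_left]
    rintro _ ⟨j, hj, rfl⟩ ⟨i, hi, h⟩
    simp only [Prod.mk.injEq] at h
    exact hkJ (h.1 ▸ hi)
  have hd2 : Disjoint (Prod.mk k '' J ∪ (fun j => (j, k)) '' J) ((fun j => (j, j)) '' Λ) := by
    rw [Set.disjoint_left]
    rintro _ (⟨j, hj, rfl⟩ | ⟨j, hj, rfl⟩) ⟨i, hi, h⟩ <;> simp only [Prod.mk.injEq] at h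
    · exact hkJ (h.1 ▸ h.2 ▸ hj)
    · exact hkJ (h.2 ▸ h.1 ▸ hj)
  have hi2 : Function.Injective fun j : A => (j, k) := fun a b h => congrArg Prod.fst h
  have hi3 : Function.Injective fun j : A => (j, j) := fun a b h => congrArg Prod.fst h
  rw [relOrder, hL, hR, hP, hB, Set.ncard_union_eq hd2, Set.ncard_union_eq hd1,
    Set.ncard_image_of_injective _ (Prod.mk_right_injective k), Set.ncard_image_of_injective _ hi2,
    Set.ncard_image_of_injective _ hi3, Set.ncard_insert_of_notMem hkJ]
  push_cast
  ring

/-- The bipartite graph is a tree on |I| + |J| vertices, hence has |I| + |J| - 1 edges. -/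
theorem IsDoubleStar.relOrder_eq [Finite A] {r : A → A → Prop} (h : IsDoubleStar r) :
    relOrder r = 0 := by
  obtain ⟨k, m, I, J, hk, hm, hr⟩ := h
  have hL : {a | ∃ b, r a b} = I := by
    ext a
    simp only [Set.mem_ofPred_eq, hr]
    constructor
    · rintro ⟨b, ⟨rfl, -⟩ | h⟩
      · exact hk
      · exact h.1
    · exact fun h => ⟨m, Or.inr ⟨h, rfl⟩⟩
  have hR : {b | ∃ a, r a b} = J := by
    ext b
    simp only [Set.mem_ofPred_eq, hr]
    constructor
    · rintro ⟨a, h | ⟨-, rfl⟩⟩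
      · exact h.2
      · exact hm
    · exact fun h => ⟨k, Or.inl ⟨rfl, h⟩⟩
  have hB : {q : A × A | r q.1 q.2} = Prod.mk k '' J ∪ (fun i => (i, m)) '' (I \ {k}) := by
    ext ⟨a, b⟩
    simp only [Set.mem_ofPred_eq, hr, Set.mem_union, Set.mem_image, Prod.mk.injEq, Set.mem_sdiff,
      Set.mem_singleton_iff]
    constructor
    · rintro (⟨rfl, h⟩ | ⟨h, rfl⟩)
      · exact Or.inl ⟨b, h, rfl, rfl⟩
      · by_cases hak : a = k
        · exact Or.inl ⟨b, hm, hak.symm, rfl⟩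
        · exact Or.inr ⟨a, ⟨h, hak⟩, rfl, rfl⟩
    · rintro (⟨j, h, rfl, rfl⟩ | ⟨j, h, rfl, rfl⟩)
      · exact Or.inl ⟨rfl, h⟩
      · exact Or.inr ⟨h.1, rfl⟩
  have hd : Disjoint (Prod.mk k '' J) ((fun i => (i, m)) '' (I \ {k})) := by
    rw [Set.disjoint_left]
    rintro _ ⟨j, hj, rfl⟩ ⟨i, hi, h⟩
    simp only [Prod.mk.injEq] at h
    exact hi.2 h.1
  have hi2 : Function.Injective fun j : A => (j, m) := fun a b h => congrArg Prod.fst h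
  have hcard := Set.ncard_sdiff_singleton_add_one hk
  rw [relOrder, hL, hR, hB, Set.ncard_union_eq hd,
    Set.ncard_image_of_injective _ (Prod.mk_right_injective k), Set.ncard_image_of_injective _ hi2]
  rw [← hcard]
  push_cast
  ring

/-- The relation obtained from `r` by restricting to and identifying letters as told by `F` on the
left and by `G` on the right. -/
def Contract (r : A → A → Prop) (F G : B → A → Prop) (a b : B) : Prop :=
  ∃ i j, r i j ∧ F a i ∧ G b j

/-- Every letter is related to one letter at most. -/
def IsFunctional (F : B → A → Prop) : Prop :=
  ∀ ⦃a a' i⦄, F a i → F a' i → a = a'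

variable {r : A → A → Prop} {F G : B → A → Prop}

theorem RelSpecial.of_contract (hF : IsFunctional F) (h : RelSpecial (Contract r F G)) :
    RelSpecial r := by
  obtain ⟨a, a', hne, ⟨b, i, j, hr, ha, -⟩, ⟨b', i', j', hr', ha', -⟩⟩ := h
  refine ⟨i, i', ?_, ⟨j, hr⟩, ⟨j', hr'⟩⟩
  rintro rfl
  exact hne (hF ha ha')

theorem flip_contract (r : A → A → Prop) (F G : B → A → Prop) :
    flip (Contract r F G) = Contract (flip r) G F := by
  funext a b
  refine propext ⟨?_, ?_⟩
  · rintro ⟨i, j, h1, h2, h3⟩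
    exact ⟨j, i, h1, h3, h2⟩
  · rintro ⟨i, j, h1, h2, h3⟩
    exact ⟨j, i, h1, h3, h2⟩

theorem RelSpecial.exists_ne (h : RelSpecial r) (a₀ : A) : ∃ a b, a ≠ a₀ ∧ r a b := by
  obtain ⟨a, a', hne, ⟨b, hb⟩, ⟨b', hb'⟩⟩ := h
  by_cases ha : a = a₀
  · exact ⟨a', b', fun h => hne (ha.trans h.symm), hb'⟩
  · exact ⟨a, b, ha, hb⟩

/-- Both centres survive: if one were discarded, every remaining edge would end at the other,
leaving one letter on that side against specialness. -/
theorem IsDoubleStar.contract (h : IsDoubleStar r) (hF : IsFunctional F) (hG : IsFunctional G)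
    (hl : RelSpecial (Contract r F G)) (hr : RelSpecial (_root_.flip (Contract r F G))) :
    IsDoubleStar (Contract r F G) := by
  obtain ⟨k, m, I, J, hk, hm, hrel⟩ := h
  obtain ⟨a₀, ha₀⟩ : ∃ a, F a k := by
    by_contra! hno
    obtain ⟨b, b', hne, ⟨a, i, j, h1, h2, h3⟩, ⟨a', i', j', h1', h2', h3'⟩⟩ := hr
    rw [hrel] at h1 h1'
    have e : j = m := by
      rcases h1 with ⟨rfl, -⟩ | h1
      · exact absurd h2 (hno a)
      · exact h1.2
    have e' : j' = m := by
      rcases h1' with ⟨rfl, -⟩ | h1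
      · exact absurd h2' (hno a')
      · exact h1.2
    subst e e'
    exact hne (hG h3 h3')
  obtain ⟨b₀, hb₀⟩ : ∃ b, G b m := by
    by_contra! hno
    obtain ⟨a, a', hne, ⟨b, i, j, h1, h2, h3⟩, ⟨b', i', j', h1', h2', h3'⟩⟩ := hl
    rw [hrel] at h1 h1'
    have e : i = k := by
      rcases h1 with h1 | ⟨-, rfl⟩
      · exact h1.1
      · exact absurd h3 (hno b)
    have e' : i' = k := by
      rcases h1' with h1 | ⟨-, rfl⟩
      · exact h1.1
      · exact absurd h3' (hno b')
    subst e e'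
    exact hne (hF h2 h2')
  refine ⟨a₀, b₀, {a | ∃ i ∈ I, F a i}, {b | ∃ j ∈ J, G b j}, ⟨k, hk, ha₀⟩, ⟨m, hm, hb₀⟩,
    fun a b => ⟨?_, ?_⟩⟩
  · rintro ⟨i, j, h1, h2, h3⟩
    rw [hrel] at h1
    rcases h1 with ⟨rfl, h1⟩ | ⟨h1, rfl⟩
    · exact Or.inl ⟨hF h2 ha₀, j, h1, h3⟩
    · exact Or.inr ⟨⟨i, h1, h2⟩, hG h3 hb₀⟩
  · rintro (⟨rfl, j, hj, hb⟩ | ⟨⟨i, hi, ha⟩, rfl⟩)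
    · exact ⟨k, j, (hrel _ _).mpr (Or.inl ⟨rfl, hj⟩), ha₀, hb⟩
    · exact ⟨i, m, (hrel _ _).mpr (Or.inr ⟨hi, rfl⟩), ha, hb₀⟩

/-- If the centre were discarded, only a loop at a single leaf could remain, against specialness;
this is why Λ may contain one leaf at most. A leaf identified with the centre turns its edges into a
loop there. -/
theorem IsStar.contract (h : IsStar r) (hF : IsFunctional F)
    (hl : RelSpecial (Contract r F F)) : IsStar (Contract r F F) := by
  obtain ⟨k, J, Λ, hkJ, hΛ, hΛ', hrel⟩ := h
  obtain ⟨a₀, ha₀⟩ : ∃ a, F a k := by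
    by_contra! hno
    obtain ⟨a, a', hne, ⟨b, i, j, h1, h2, h3⟩, ⟨b', i', j', h1', h2', h3'⟩⟩ := hl
    have key : ∀ {a b i j}, r i j → F a i → F b j → i ∈ Λ ∧ i ≠ k := by
      intro a b i j h1 h2 h3
      rw [hrel] at h1
      rcases h1 with ⟨rfl, -⟩ | ⟨-, rfl⟩ | ⟨rfl, h⟩
      · exact absurd h2 (hno a)
      · exact absurd h3 (hno b)
      · refine ⟨h, ?_⟩
        rintro rfl
        exact hno a h2
    have e := key h1 h2 h3
    have e' := key h1' h2' h3'
    have := hΛ' i e.1 i' e'.1 e.2 e'.2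
    subst this
    exact hne (hF h2 h2')
  refine ⟨a₀, {b | b ≠ a₀ ∧ ∃ j ∈ J, F b j},
    {a | (∃ i ∈ Λ, F a i) ∨ (a = a₀ ∧ ∃ j ∈ J, F a₀ j)}, fun h => h.1 rfl, ?_, ?_,
    fun a b => ⟨?_, ?_⟩⟩
  · rintro a (⟨i, hi, ha⟩ | ⟨h, -⟩)
    · rcases hΛ i hi with rfl | h
      · exact Or.inl (hF ha ha₀)
      · by_cases haa : a = a₀
        · exact Or.inl haa
        · exact Or.inr ⟨haa, i, h, ha⟩
    · exact Or.inl h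
  · rintro a (⟨i, hi, ha⟩ | ⟨h, -⟩) a' (⟨i', hi', ha'⟩ | ⟨h', -⟩) hne hne'
    · have e : i ≠ k := by
        rintro rfl
        exact hne (hF ha ha₀)
      have e' : i' ≠ k := by
        rintro rfl
        exact hne' (hF ha' ha₀)
      have := hΛ' i hi i' hi' e e'
      subst this
      exact hF ha ha'
    · exact absurd h' hne'
    · exact absurd h hne
    · exact absurd h hne
  · rintro ⟨i, j, h1, h2, h3⟩
    rw [hrel] at h1
    rcases h1 with ⟨rfl, h1⟩ | ⟨h1, rfl⟩ | ⟨rfl, h1⟩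
    · have e := hF h2 ha₀
      subst e
      by_cases hb : b = a
      · subst hb
        exact Or.inr (Or.inr ⟨rfl, Or.inr ⟨rfl, j, h1, h3⟩⟩)
      · exact Or.inl ⟨rfl, hb, j, h1, h3⟩
    · have e := hF h3 ha₀
      subst e
      by_cases hb : a = b
      · subst hb
        exact Or.inr (Or.inr ⟨rfl, Or.inr ⟨rfl, i, h1, h2⟩⟩)
      · exact Or.inr (Or.inl ⟨⟨hb, i, h1, h2⟩, rfl⟩)
    · exact Or.inr (Or.inr ⟨hF h2 h3, Or.inl ⟨i, h1, h2⟩⟩)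
  · rintro (⟨rfl, -, j, hj, hb⟩ | ⟨⟨-, i, hi, ha⟩, rfl⟩ | ⟨rfl, ⟨i, hi, ha⟩ | ⟨rfl, j, hj, hb⟩⟩)
    · exact ⟨k, j, (hrel _ _).mpr (Or.inl ⟨rfl, hj⟩), ha₀, hb⟩
    · exact ⟨i, k, (hrel _ _).mpr (Or.inr (Or.inl ⟨hi, rfl⟩)), ha, ha₀⟩
    · exact ⟨i, i, (hrel _ _).mpr (Or.inr (Or.inr ⟨rfl, hi⟩)), ha, ha⟩
    · exact ⟨k, j, (hrel _ _).mpr (Or.inl ⟨rfl, hj⟩), ha₀, hb⟩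

theorem IsStar.flip_eq (h : IsStar r) : flip r = r := by
  funext i j
  exact propext ⟨fun hij => h.symm hij, fun hij => h.symm hij⟩

/-- Every letter that survives on the right is identified with `a₀` on the left. Loops thus become
edges at `a₀`, and the edge from a surviving leaf to `k` joins the two centres. -/
theorem IsStarAt.contract_of_nested {k : A} {J Λ : Set A} (h : IsStarAt r k J Λ)
    (hF : IsFunctional F) (hG : IsFunctional G) (hr : RelSpecial (flip (Contract r F G)))
    {a₀ b₀ : B} (ha₀ : F a₀ k) (hb₀ : G b₀ k) (hN : ∀ b j, G b j → F a₀ j) :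
    IsDoubleStar (Contract r F G) := by
  obtain ⟨hkJ, hΛ, -, hrel⟩ := h
  obtain ⟨j₁, hj₁, b₁, hb₁⟩ : ∃ j ∈ J, ∃ b, G b j := by
    obtain ⟨b, a, hb, i, j, h1, h2, h3⟩ := hr.exists_ne b₀
    rw [hrel] at h1
    rcases h1 with ⟨-, h1⟩ | ⟨-, rfl⟩ | ⟨rfl, h1⟩
    · exact ⟨j, h1, b, h3⟩
    · exact absurd (hG h3 hb₀) hb
    · rcases hΛ i h1 with rfl | h
      · exact absurd (hG h3 hb₀) hb
      · exact ⟨i, h, b, h3⟩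
  refine ⟨a₀, b₀, {a | a = a₀ ∨ ∃ i ∈ J, F a i}, {b | b = b₀ ∨ ∃ j ∈ J, G b j}, Or.inl rfl,
    Or.inl rfl, fun a b => ⟨?_, ?_⟩⟩
  · rintro ⟨i, j, h1, h2, h3⟩
    rw [hrel] at h1
    rcases h1 with ⟨rfl, h1⟩ | ⟨h1, rfl⟩ | ⟨rfl, h1⟩
    · exact Or.inl ⟨hF h2 ha₀, Or.inr ⟨j, h1, h3⟩⟩
    · exact Or.inr ⟨Or.inr ⟨i, h1, h2⟩, hG h3 hb₀⟩
    · refine Or.inl ⟨hF h2 (hN b i h3), ?_⟩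
      rcases hΛ i h1 with rfl | h
      · exact Or.inl (hG h3 hb₀)
      · exact Or.inr ⟨i, h, h3⟩
  · have h00 : Contract r F G a₀ b₀ :=
      ⟨j₁, k, (hrel _ _).mpr (Or.inr (Or.inl ⟨hj₁, rfl⟩)), hN b₁ j₁ hb₁, hb₀⟩
    rintro (⟨rfl, rfl | ⟨j, hj, hb⟩⟩ | ⟨rfl | ⟨i, hi, ha⟩, rfl⟩)
    · exact h00
    · exact ⟨k, j, (hrel _ _).mpr (Or.inl ⟨rfl, hj⟩), ha₀, hb⟩
    · exact h00
    · exact ⟨i, k, (hrel _ _).mpr (Or.inr (Or.inl ⟨hi, rfl⟩)), ha, hb₀⟩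

/-- Without `k` on the left only edges from leaves to `k` and one leaf loop can remain. Specialness
on the right requires both kinds, and the looped leaf `l` supplies the left centre. -/
theorem IsStarAt.contract_of_forall_not {k : A} {J Λ : Set A} (h : IsStarAt r k J Λ)
    (hF : IsFunctional F) (hG : IsFunctional G) (hr : RelSpecial (flip (Contract r F G)))
    (hno : ∀ a, ¬ F a k) : IsDoubleStar (Contract r F G) := by
  obtain ⟨hkJ, hΛ, hΛ', hrel⟩ := h
  have key : ∀ {a b i j}, r i j → F a i → G b j → (i ∈ J ∧ j = k) ∨ (i = j ∧ i ∈ Λ ∧ i ≠ k) := by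
    intro a b i j h1 h2 h3
    rw [hrel] at h1
    rcases h1 with ⟨rfl, -⟩ | h1 | ⟨rfl, h1⟩
    · exact absurd h2 (hno a)
    · exact Or.inl h1
    · refine Or.inr ⟨rfl, h1, ?_⟩
      rintro rfl
      exact hno a h2
  obtain ⟨b₀, hb₀⟩ : ∃ b, G b k := by
    by_contra! hno'
    obtain ⟨b, b', hne, ⟨a, i, j, h1, h2, h3⟩, ⟨a', i', j', h1', h2', h3'⟩⟩ := hr
    rcases key h1 h2 h3 with ⟨-, rfl⟩ | ⟨rfl, e1, e2⟩
    · exact hno' _ h3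
    rcases key h1' h2' h3' with ⟨-, rfl⟩ | ⟨rfl, e1', e2'⟩
    · exact hno' _ h3'
    have := hΛ' i e1 i' e1' e2 e2'
    subst this
    exact hne (hG h3 h3')
  obtain ⟨b₁, a₁, hb, l, j, h1, h2, h3⟩ := hr.exists_ne b₀
  rcases key h1 h2 h3 with ⟨-, rfl⟩ | ⟨rfl, hl, hlk⟩
  · exact absurd (hG h3 hb₀) hb
  have hlJ : l ∈ J := (hΛ l hl).resolve_left hlk
  refine ⟨a₁, b₀, {a | ∃ i ∈ J, F a i}, {b₀, b₁}, ⟨l, hlJ, h2⟩, Or.inl rfl, fun a b => ⟨?_, ?_⟩⟩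
  · rintro ⟨i, j, h1', h2', h3'⟩
    rcases key h1' h2' h3' with ⟨hi, rfl⟩ | ⟨rfl, e1, e2⟩
    · exact Or.inr ⟨⟨i, hi, h2'⟩, hG h3' hb₀⟩
    · have := hΛ' i e1 l hl e2 hlk
      subst this
      exact Or.inl ⟨hF h2' h2, Or.inr (hG h3' h3)⟩
  · rintro (⟨rfl, rfl | rfl⟩ | ⟨⟨i, hi, ha⟩, rfl⟩)
    · exact ⟨l, k, (hrel _ _).mpr (Or.inr (Or.inl ⟨hlJ, rfl⟩)), h2, hb₀⟩
    · exact ⟨l, l, h1, h2, h3⟩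
    · exact ⟨i, k, (hrel _ _).mpr (Or.inr (Or.inl ⟨hi, rfl⟩)), ha, hb₀⟩

/-- Contracting a star by two nested identifications yields a double star. -/
theorem IsStar.contract_of_nested (h : IsStar r) (hF : IsFunctional F) (hG : IsFunctional G)
    (hl : RelSpecial (Contract r F G)) (hr : RelSpecial (flip (Contract r F G)))
    (hN : ∀ a b i, F a i → G b i → (∀ b' j, G b' j → F a j) ∨ ∀ a' j, F a' j → G b j) :
    IsDoubleStar (Contract r F G) := by
  have hfl := h.flip_eq
  have hswap : flip (Contract r F G) = Contract r G F := by rw [flip_contract, hfl]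
  have hswap' : flip (Contract r G F) = Contract r F G := by rw [flip_contract, hfl]
  obtain ⟨k, J, Λ, h⟩ := h
  have hl' : RelSpecial (flip (Contract r G F)) := by rwa [hswap']
  by_cases h1 : ∃ a, F a k
  · by_cases h2 : ∃ b, G b k
    · obtain ⟨a₀, ha₀⟩ := h1
      obtain ⟨b₀, hb₀⟩ := h2
      rcases hN a₀ b₀ k ha₀ hb₀ with hn | hn
      · exact h.contract_of_nested hF hG hr ha₀ hb₀ hn
      · rw [← hswap']
        exact (h.contract_of_nested hG hF hl' hb₀ ha₀ hn).flip
    · push Not at h2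
      rw [← hswap']
      exact (h.contract_of_forall_not hG hF hl' h2).flip
  · push Not at h1
    exact h.contract_of_forall_not hF hG hr h1

end Stars

/-! ### Regular extension relations -/

section Regular

variable {A B : Type*}

/-- The extension relation of a palindrome is a star, that of any other word a double star. -/
def IsRegular (u : ℕ → A) (w : List A) : Prop :=
  (w.Palindrome → IsStar (Ext u w)) ∧ (¬ w.Palindrome → IsDoubleStar (Ext u w))

theorem IsRegular.hasRichOrder [Finite A] {u : ℕ → A} (hu : HasPalPrefixes u) {w : List A}
    (hw : IsBispecial u w) (h : IsRegular u w) : HasRichOrder u w := by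
  rw [HasRichOrder, hu.bilateralOrder_eq, ncard_Pext]
  exact ⟨fun hp => (h.2 hp).relOrder_eq,
    fun hp => (h.1 hp).relOrder_eq (hu.isBispecial_iff.mp hw).1⟩

theorem isFunctional_suffix (η : A → List B) (s : List B) :
    IsFunctional fun (a : B) i => a :: s <:+ η i := by
  intro a a' i h h'
  have := (List.suffix_of_suffix_length_le h h' (by simp)).eq_of_length (by simp)
  exact (List.cons.inj this).1

theorem cons_suffix_of_length_lt {s t z : List B} {a b : B} (hs : a :: s <:+ z)
    (ht : b :: t <:+ z) (h : s.length < t.length) : a :: s <:+ t :=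
  List.suffix_of_suffix_length_le hs ((List.suffix_cons b t).trans ht) (by simpa using h)

/-- Regularity passes to the bispecial factors of the image that contain the common palindrome. -/
theorem IsClassPret.isRegular {η : A → List B} {p : List B} (hη : IsClassPret η p) {u : ℕ → A}
    (hu : HasPalPrefixes u) {w : List B} (hw : IsBispecial (onSeq η hη.ne_nil u) w)
    (hpw : p <:+: w)
    (hreg : ∀ x, x.length + p.length ≤ w.length → IsBispecial u x → IsRegular u x) :
    IsRegular (onSeq η hη.ne_nil u) w := by
  obtain ⟨s, x, t, hdec, hext, hpal⟩ := hη.desubstitute u hw.1.1 hpw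
  obtain ⟨hl, hr⟩ := (hη.hasPalPrefixes_onSeq hu).isBispecial_iff.mp hw
  have hC : Ext (onSeq η hη.ne_nil u) w =
      Contract (Ext u x) (fun a i => a :: s <:+ η i) (fun b j => b :: t <:+ η j) := by
    funext a b
    exact propext (hext a b)
  have hF := isFunctional_suffix η s
  have hG := isFunctional_suffix η t
  rw [hC] at hl hr
  have hx : IsRegular u x := by
    refine hreg x ?_ (hu.isBispecial_iff.mpr ⟨hl.of_contract hF, ?_⟩)
    · have := le_length_onWord η 1 (fun a => List.length_pos_iff.mpr (hη.ne_nil a)) x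
      have := congrArg List.length hdec
      simp only [List.length_append] at this
      omega
    · rw [flip_contract] at hr
      exact hr.of_contract hG
  unfold IsRegular
  rw [hC]
  constructor
  · intro hp
    obtain ⟨hxp, rfl⟩ := hpal.mp hp
    exact (hx.1 hxp).contract hF hl
  · intro hp
    by_cases hxp : x.Palindrome
    · have hst : s ≠ t := fun h => hp (hpal.mpr ⟨hxp, h⟩)
      refine (hx.1 hxp).contract_of_nested hF hG hl hr fun a b i ha hb => ?_
      -- Both `a :: s` and `b :: t` are suffixes of the same η(i), so equal lengths would give `s =
      -- t`. Otherwise the shorter one is a suffix of the tail of the longer, which gives the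
      -- nesting.
      rcases lt_trichotomy s.length t.length with hlt | heq | hlt
      · have := cons_suffix_of_length_lt ha hb hlt
        exact Or.inl fun b' j h => this.trans ((List.suffix_cons b' t).trans h)
      · have := (List.suffix_of_suffix_length_le ha hb (by simp [heq])).eq_of_length
          (by simp [heq])
        exact absurd (List.cons.inj this).2 hst
      · have := cons_suffix_of_length_lt hb ha hlt
        exact Or.inr fun a' j h => this.trans ((List.suffix_cons a' s).trans h)
    · exact (hx.2 hxp).contract hF hG hl hr

end Regular

/-! ### The sequence `u_d` -/

section USeq

theorem occursAt_singleton_iff {A : Type*} {a : A} {z : List A} {j : ℕ} :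
    OccursAt [a] z j ↔ z[j]? = some a := by
  constructor
  · rintro ⟨s, t, rfl, rfl⟩
    simp
  · intro h
    obtain ⟨hj, rfl⟩ := List.getElem?_eq_some_iff.mp h
    refine ⟨z.take j, z.drop (j + 1), ?_, by simp; omega⟩
    simp

variable {d : ℕ} (hd : 3 ≤ d)

/-- The letter `0`. -/
def zeroLetter : Fin d := ⟨0, by omega⟩

/-- The letter `d - 1`. -/
def lastLetter : Fin d := ⟨d - 1, by omega⟩

theorem lastLetter_ne_zeroLetter : lastLetter hd ≠ zeroLetter hd := by
  simp only [lastLetter, zeroLetter, ne_eq, Fin.mk.injEq]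
  omega

theorem phi_of_lt {i : ℕ} (h : i + 1 < d) :
    phi d ⟨i, by omega⟩ = [zeroLetter hd, ⟨i + 1, h⟩] := by
  simp [phi, h, zeroLetter]

theorem phi_lastLetter :
    phi d (lastLetter hd) = [zeroLetter hd, lastLetter hd, lastLetter hd] := by
  have : ¬ d - 1 + 1 < d := by omega
  simp [phi, lastLetter, zeroLetter, this]

theorem eq_lastLetter_or (i : Fin d) :
    i = lastLetter hd ∨ ∃ h : (i : ℕ) + 1 < d, phi d i = [zeroLetter hd, ⟨i + 1, h⟩] := by
  by_cases h : (i : ℕ) + 1 < d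
  · exact Or.inr ⟨h, phi_of_lt hd h⟩
  · left
    ext
    simp only [lastLetter]
    omega

theorem succ_ne_zeroLetter {i : ℕ} (h : i + 1 < d) : (⟨i + 1, h⟩ : Fin d) ≠ zeroLetter hd := by
  simp [zeroLetter]

theorem head_onWord_phi (x : List (Fin d)) (a : Fin d) (y : List (Fin d))
    (h : onWord (phi d) x = a :: y) : a = zeroLetter hd := by
  cases x with
  | nil => simp [onWord] at h
  | cons i x =>
    rw [onWord_cons] at h
    rcases eq_lastLetter_or hd i with rfl | ⟨hi, e⟩
    · rw [phi_lastLetter] at h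
      exact (List.cons.inj h).1.symm
    · rw [e] at h
      exact (List.cons.inj h).1.symm

/-- The image of d-2 is a proper prefix of that of d-1. The next letter decides between them, since
every image begins with 0. -/
theorem onWord_phi_injective {d : ℕ} (hd : 3 ≤ d) : Function.Injective (onWord (phi d)) := by
  intro x
  induction x with
  | nil =>
    intro y h
    have := le_length_onWord (phi d) 2 (two_le_length_phi d) y
    rw [← h] at this
    simp only [onWord, List.flatMap_nil, List.length_nil] at this
    exact (List.length_eq_zero_iff.mp (by omega)).symm
  | cons i x ih =>
    intro y h
    cases y with
    | nil =>
      have := le_length_onWord (phi d) 2 (two_le_length_phi d) (i :: x)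
      rw [h] at this
      simp [onWord] at this
    | cons j y =>
      simp only [onWord_cons] at h
      rcases eq_lastLetter_or hd i with rfl | ⟨hi, ei⟩ <;>
        rcases eq_lastLetter_or hd j with rfl | ⟨hj, ej⟩
      · rw [ih (List.append_cancel_left h)]
      · rw [phi_lastLetter, ej] at h
        simp only [List.cons_append, List.nil_append, List.cons.injEq] at h
        exact absurd (head_onWord_phi hd y _ _ h.2.2.symm) (lastLetter_ne_zeroLetter hd)
      · rw [phi_lastLetter, ei] at h
        simp only [List.cons_append, List.nil_append, List.cons.injEq] at h
        exact absurd (head_onWord_phi hd x _ _ h.2.2) (lastLetter_ne_zeroLetter hd)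
      · rw [ei, ej] at h
        simp only [List.cons_append, List.nil_append, List.cons.injEq, true_and, Fin.mk.injEq,
          add_left_inj] at h
        rw [ih h.2, Fin.ext h.1]

theorem isClassPret_phi : IsClassPret (phi d) [zeroLetter hd] where
  injective := onWord_phi_injective hd
  palindrome := List.Palindrome.singleton _
  eq_append i := by
    rcases eq_lastLetter_or hd i with rfl | ⟨hi, e⟩
    · exact ⟨[lastLetter hd, lastLetter hd], List.Palindrome.of_reverse_eq rfl, phi_lastLetter hd⟩
    · exact ⟨_, List.Palindrome.singleton _, e⟩
  completeReturn i := by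
    refine ⟨phi d i, phi_ne_nil d i, rfl, fun j => ?_⟩
    rw [occursAt_singleton_iff]
    rcases eq_lastLetter_or hd i with rfl | ⟨hi, e⟩
    · have := lastLetter_ne_zeroLetter hd
      rw [phi_lastLetter]
      rcases j with _ | _ | _ | _ | j <;> simp [this]
    · have := succ_ne_zeroLetter hd hi
      rw [e]
      rcases j with _ | _ | _ | j <;> simp [this]

theorem onSeq_phi : onSeq (phi d) (isClassPret_phi hd).ne_nil (uSeq d hd) = uSeq d hd :=
  onSeq_phi_uSeq d hd

theorem block_uSeq_cut (k n : ℕ) :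
    block (uSeq d hd) (cut (phi d) (uSeq d hd) k)
      ((onWord (phi d) (block (uSeq d hd) k n)).length + 1) =
      onWord (phi d) (block (uSeq d hd) k n) ++ [zeroLetter hd] := by
  have := (isClassPret_phi hd).block_onSeq_append (uSeq d hd) k n
  rwa [onSeq_phi] at this

theorem block_uSeq_cut_letter (k : ℕ) :
    block (uSeq d hd) (cut (phi d) (uSeq d hd) k) ((phi d (uSeq d hd k)).length + 1) =
      phi d (uSeq d hd k) ++ [zeroLetter hd] := by
  have := block_uSeq_cut hd k 1
  rwa [block_one, onWord_singleton] at this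

/-- The map x ↦ φ(x)0 sends palindromic prefixes to longer palindromic prefixes. -/
theorem hasPalPrefixes_uSeq : HasPalPrefixes (uSeq d hd) := by
  intro N
  induction N with
  | zero => exact ⟨0, le_rfl, List.Palindrome.nil⟩
  | succ N ih =>
    obtain ⟨n, hn, hp⟩ := ih
    have hb := block_uSeq_cut hd 0 n
    rw [cut_zero] at hb
    refine ⟨(onWord (phi d) (block (uSeq d hd) 0 n)).length + 1, ?_, ?_⟩
    · have := le_length_onWord (phi d) 2 (two_le_length_phi d) (block (uSeq d hd) 0 n)
      rw [length_block] at this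
      omega
    · rw [hb]
      refine List.Palindrome.of_reverse_eq ?_
      rw [(isClassPret_phi hd).reverse_onWord_append, hp.reverse_eq]

theorem singleton_mem_language (i : Fin d) : [i] ∈ language (uSeq d hd) := by
  obtain ⟨i, hi⟩ := i
  induction i with
  | zero =>
    have := block_mem_language (uSeq d hd) 0 1
    rw [block_one, uSeq_eq d hd 0 0 (by simp [phiIter])] at this
    simpa [phiIter] using this
  | succ i ih =>
    obtain ⟨k, hk⟩ := ih (by omega)
    rw [List.length_singleton, block_one, List.singleton_inj] at hk
    refine mem_language_of_infix (block_mem_language (uSeq d hd) (cut (phi d) (uSeq d hd) k)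
      ((phi d (uSeq d hd k)).length + 1)) ?_
    rw [block_uSeq_cut_letter, ← hk, phi_of_lt hd hi]
    exact ⟨[zeroLetter hd], [zeroLetter hd], rfl⟩

theorem phi_append_mem_language (i : Fin d) :
    phi d i ++ [zeroLetter hd] ∈ language (uSeq d hd) := by
  obtain ⟨k, hk⟩ := singleton_mem_language hd i
  rw [List.length_singleton, block_one, List.singleton_inj] at hk
  rw [hk, ← block_uSeq_cut_letter]
  exact block_mem_language _ _ _

/-- The local structure of `u_d`. -/
theorem uSeq_local (m : ℕ) :
    (uSeq d hd m = zeroLetter hd ∧ uSeq d hd (m + 1) ≠ zeroLetter hd) ∨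
    (uSeq d hd m ≠ zeroLetter hd ∧ uSeq d hd (m + 1) = zeroLetter hd) ∨
    (uSeq d hd m = lastLetter hd ∧ uSeq d hd (m + 1) = lastLetter hd ∧
      uSeq d hd (m + 2) = zeroLetter hd) := by
  obtain ⟨k, r, rfl, hr⟩ := exists_cut_le (phi_ne_nil d) (uSeq d hd) m
  have hb := block_uSeq_cut_letter hd k
  generalize cut (phi d) (uSeq d hd) k = c at hb ⊢
  rcases eq_lastLetter_or hd (uSeq d hd k) with e | ⟨hi, e⟩
  · have hne := lastLetter_ne_zeroLetter hd
    rw [e, phi_lastLetter] at hb hr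
    simp only [List.length_cons, List.length_nil, block_succ', block_zero, List.cons_append,
      List.nil_append, List.cons.injEq, and_true] at hb hr
    obtain ⟨h0, h1, h2, h3⟩ := hb
    obtain rfl | rfl | rfl : r = 0 ∨ r = 1 ∨ r = 2 := by omega
    · exact Or.inl ⟨h0, by rw [add_zero, h1]; exact hne⟩
    · exact Or.inr (Or.inr ⟨h1, h2, h3⟩)
    · exact Or.inr (Or.inl ⟨by rw [show c + 2 = c + 1 + 1 from rfl, h2]; exact hne, h3⟩)
  · have hne := succ_ne_zeroLetter hd hi
    rw [e] at hb hr
    simp only [List.length_cons, List.length_nil, block_succ', block_zero, List.cons_append,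
      List.nil_append, List.cons.injEq, and_true] at hb hr
    obtain ⟨h0, h1, h2⟩ := hb
    obtain rfl | rfl : r = 0 ∨ r = 1 := by omega
    · exact Or.inl ⟨h0, by rw [add_zero, h1]; exact hne⟩
    · exact Or.inr (Or.inl ⟨by rw [h1]; exact hne, h2⟩)

theorem zero_cons_mem_language {b : Fin d} (hb : b ≠ zeroLetter hd) :
    [zeroLetter hd, b, zeroLetter hd] ∈ language (uSeq d hd) := by
  obtain ⟨b, hbd⟩ := b
  cases b with
  | zero => exact absurd rfl hb
  | succ i =>
    have := phi_append_mem_language hd ⟨i, by omega⟩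
    rwa [phi_of_lt hd hbd] at this

theorem zero_last_mem_language :
    [zeroLetter hd, lastLetter hd, lastLetter hd, zeroLetter hd] ∈ language (uSeq d hd) := by
  have := phi_append_mem_language hd (lastLetter hd)
  rwa [phi_lastLetter] at this

theorem isStar_nil : IsStar (Ext (uSeq d hd) []) := by
  refine ⟨zeroLetter hd, {i | i ≠ zeroLetter hd}, {lastLetter hd}, fun h => h rfl, ?_, ?_,
    fun a b => ⟨?_, ?_⟩⟩
  · rintro i rfl
    exact Or.inr (lastLetter_ne_zeroLetter hd)
  · rintro i rfl j rfl _ _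
    rfl
  · rintro ⟨m, hm⟩
    have hm' : [a, b] = [uSeq d hd m, uSeq d hd (m + 1)] := hm
    simp only [List.cons.injEq, and_true] at hm'
    obtain ⟨rfl, rfl⟩ := hm'
    rcases uSeq_local hd m with h | h | ⟨h1, h2, -⟩
    · exact Or.inl h
    · exact Or.inr (Or.inl h)
    · exact Or.inr (Or.inr ⟨h1.trans h2.symm, h1⟩)
  · rintro (⟨rfl, hb⟩ | ⟨ha, rfl⟩ | ⟨rfl, rfl⟩)
    · exact mem_language_of_infix (zero_cons_mem_language hd hb) ⟨[], [zeroLetter hd], rfl⟩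
    · exact mem_language_of_infix (zero_cons_mem_language hd ha) ⟨[zeroLetter hd], [], rfl⟩
    · exact mem_language_of_infix (zero_last_mem_language hd)
        ⟨[zeroLetter hd], [zeroLetter hd], rfl⟩

/-- The words 0(d-1)0 and 0(d-1)(d-1)0 give all extensions: a loop at the centre 0 and the single
leaf d-1. -/
theorem isStar_lastLetter : IsStar (Ext (uSeq d hd) [lastLetter hd]) := by
  have hne := lastLetter_ne_zeroLetter hd
  refine ⟨zeroLetter hd, {lastLetter hd}, {zeroLetter hd}, fun h => hne h.symm,
    fun i hi => Or.inl hi, fun i hi _ _ h => absurd hi h, fun a b => ⟨?_, ?_⟩⟩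
  · rintro ⟨m, hm⟩
    have hm' : [a, lastLetter hd, b] = [uSeq d hd m, uSeq d hd (m + 1), uSeq d hd (m + 2)] := hm
    simp only [List.cons.injEq, and_true] at hm'
    obtain ⟨rfl, h1, rfl⟩ := hm'
    have hloc := uSeq_local hd m
    have hloc' := uSeq_local hd (m + 1)
    rw [← h1] at hloc hloc'
    rcases hloc with ⟨h, -⟩ | ⟨-, h⟩ | ⟨h, -, h'⟩
    · rcases hloc' with ⟨e, -⟩ | ⟨-, e⟩ | ⟨-, e, -⟩
      · exact absurd e hne
      · exact Or.inr (Or.inr ⟨h.trans e.symm, h⟩)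
      · exact Or.inl ⟨h, e⟩
    · exact absurd h hne
    · exact Or.inr (Or.inl ⟨h, h'⟩)
  · rintro (⟨rfl, rfl⟩ | ⟨rfl, rfl⟩ | ⟨rfl, rfl⟩)
    · exact mem_language_of_infix (zero_last_mem_language hd) ⟨[], [zeroLetter hd], rfl⟩
    · exact mem_language_of_infix (zero_last_mem_language hd) ⟨[zeroLetter hd], [], rfl⟩
    · exact zero_cons_mem_language hd hne

/-- A non-zero letter before a non-empty word without 0 can only be the first half of (d-1)(d-1),
which is followed by 0. The word is then the second d-1. -/
theorem eq_nil_or_of_isBispecial {w : List (Fin d)} (hw : IsBispecial (uSeq d hd) w)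
    (h0 : ¬ [zeroLetter hd] <:+: w) : w = [] ∨ w = [lastLetter hd] := by
  rcases w with _ | ⟨c, w⟩
  · exact Or.inl rfl
  right
  have hmem : zeroLetter hd ∉ c :: w := by
    intro h
    obtain ⟨s, t, e⟩ := List.append_of_mem h
    exact h0 ⟨s, t, by simp [e]⟩
  obtain ⟨a, b, ha, hab⟩ :=
    ((hasPalPrefixes_uSeq hd).isBispecial_iff.mp hw).1.exists_ne (zeroLetter hd)
  obtain ⟨m, hm⟩ := exists_ext_right.mp ⟨b, hab⟩
  simp only [List.length_cons, block_succ', List.cons.injEq] at hm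
  obtain ⟨rfl, rfl, hw'⟩ := hm
  rcases uSeq_local hd m with h | h | ⟨-, h1, h2⟩
  · exact absurd h.1 ha
  · exact absurd (h.2 ▸ List.mem_cons_self) hmem
  · rcases w with _ | ⟨e, w⟩
    · rw [h1]
    · simp only [List.length_cons, block_succ', List.cons.injEq] at hw'
      exact absurd (by simp [hw'.1, ← h2]) hmem

/-- All bispecial factors of `u_d` are regular. -/
theorem isRegular_uSeq (w : List (Fin d)) (hw : IsBispecial (uSeq d hd) w) :
    IsRegular (uSeq d hd) w := by
  induction hn : w.length using Nat.strong_induction_on generalizing w with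
  | _ n ih =>
    by_cases h0 : [zeroLetter hd] <:+: w
    -- View u_d as its own image under φ_d. As the common palindrome 0 has length 1, the preimage is
    -- strictly shorter.
    · rw [← onSeq_phi hd] at hw ⊢
      refine (isClassPret_phi hd).isRegular (hasPalPrefixes_uSeq hd) hw h0 fun x hx hxb => ?_
      rw [List.length_singleton] at hx
      exact ih x.length (by omega) x hxb rfl
    · rcases eq_nil_or_of_isBispecial hd hw h0 with rfl | rfl
      · exact ⟨fun _ => isStar_nil hd, fun h => absurd List.Palindrome.nil h⟩
      · exact ⟨fun _ => isStar_lastLetter hd, fun h => absurd (List.Palindrome.singleton _) h⟩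

end USeq

end RichWords

theorem mainTheorem5 (d : ℕ) (hd : 3 ≤ d) {B : Type*} [Finite B]
    (η : Fin d → List B) (p : List B) (hη : RichWords.IsClassPret η p)
    (hb : ∀ w : List B,
      RichWords.IsBispecial (RichWords.onSeq η hη.ne_nil (RichWords.uSeq d hd)) w →
      ¬ p <:+: w →
        (¬ w.Palindrome →
          RichWords.bilateralOrder (RichWords.onSeq η hη.ne_nil (RichWords.uSeq d hd)) w = 0) ∧
        (w.Palindrome →
          RichWords.bilateralOrder (RichWords.onSeq η hη.ne_nil (RichWords.uSeq d hd)) w =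
            ((RichWords.Pext (RichWords.onSeq η hη.ne_nil (RichWords.uSeq d hd)) w).ncard : ℤ)
              - 1)) :
    RichWords.IsRich (RichWords.onSeq η hη.ne_nil (RichWords.uSeq d hd)) := by
  have hu := RichWords.hasPalPrefixes_uSeq hd
  refine RichWords.isRich_of_bispecial (hη.hasPalPrefixes_onSeq hu) fun w hw => ?_
  by_cases hpw : p <:+: w
  · exact (hη.isRegular hu hw hpw fun x _ hx => RichWords.isRegular_uSeq hd x hx).hasRichOrder
      (hη.hasPalPrefixes_onSeq hu) hw
  · exact hb w hw hpw
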